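/- Throughout, a lattice polytope in $\mathbb{R}^n$ is the convex hull of a nonempty finite subset of $\mathbb{Z}^n$, and $P\cong Q$ means that an affine isomorphism of the ambient spaces which maps the lattice onto the lattice maps $P$ onto $Q$. A lattice polytope $P\subset\mathbb{R}^n$ is smooth if at each of its vertices the primitive edge-directions form a basis of $\mathbb{Z}^n$. For lattice polytopes $P_0,\dots,P_r\subset\mathbb{R}^m$ and $s\in\mathbb{N}=\{0,1,2,\dots\}$ let $$[P_0*\cdots*P_r]^s:=\operatorname{conv}\bigl((P_0\times 0)\cup(P_1\times s e_1)\cup\cdots\cup(P_r\times s e_r)\bigr)\subset\mathbb{R}^m\times\mathbb{R}^r,$$ where $e_1,\dots,e_r$ is the standard basis of $\mathbb{R}^r$. A lattice polytope $P$ is a strict Cayley polytope of order $s$ if $P\cong[P_0*\cdots*P_r]^s$ for some $r$ and some lattice polytopes $P_0,\dots,P_r$ of dimension less than $\dim P$ which are normally equivalent, i.e. all have the same normal fan. **Proposition 3.6.** Let $P$ be a smooth lattice polytope of dimension at most $3$. If $P\cong[P_0*P_1]^k$ for some $k\in\mathbb{N}$ and some lattice polytopes $P_0,P_1$ of dimension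 less than $\dim P$, then $P$ is a strict Cayley polytope of order $k$. -/

import Mathlib

/-- The lattice `ℤ^ι` inside `ℝ^ι`. -/
def latticePoints (ι : Type*) : Set (ι → ℝ) :=
  Set.range fun (z : ι → ℤ) (i : ι) => (z i : ℝ)

/-- A (nonempty, convex) lattice polytope: the convex hull of a nonempty finite set of lattice
points. -/
def IsLatticePolytope {ι : Type*} (P : Set (ι → ℝ)) : Prop :=
  ∃ S : Set (ι → ℝ), S.Finite ∧ S.Nonempty ∧ S ⊆ latticePoints ι ∧ P = convexHull ℝ S

/-- The dimension of a polytope, i.e. of its affine hull. -/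
noncomputable def polytopeDim {ι : Type*} (P : Set (ι → ℝ)) : ℕ :=
  Module.finrank ℝ (vectorSpan ℝ P)

/-- An integer vector is primitive if it is not a multiple `c • d'` of an integer vector with
`c ≠ ±1`. (In particular it is nonzero.) -/
def IsPrimitiveVector {ι : Type*} (d : ι → ℤ) : Prop :=
  ∀ (c : ℤ) (d' : ι → ℤ), d = c • d' → IsUnit c

/-- The edge-directions of `P` at `v`: the primitive integer vectors pointing from `v` along an
edge of `P` (a nondegenerate segment that is a face of `P`) with endpoint `v`. -/
def edgeDirections {ι : Type*} (P : Set (ι → ℝ)) (v : ι → ℝ) : Set (ι → ℤ) :=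
  {d | IsPrimitiveVector d ∧ ∃ w : ι → ℝ, w ≠ v ∧ IsExposed ℝ P (segment ℝ v w) ∧
    ∃ t : ℝ, 0 < t ∧ w - v = t • fun i => (d i : ℝ)}

/-- A smooth polytope: a lattice polytope whose edge-directions at every vertex form a basis of
the lattice `ℤ^ι`. -/
def IsSmoothPolytope {ι : Type*} (P : Set (ι → ℝ)) : Prop :=
  IsLatticePolytope P ∧ ∀ v ∈ Set.extremePoints ℝ P,
    LinearIndependent ℤ (fun d : edgeDirections P v => (d : ι → ℤ)) ∧
    Submodule.span ℤ (edgeDirections P v) = ⊤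

/-- `P ≅ Q`: some affine isomorphism of the ambient spaces that maps the lattice onto the lattice
maps `P` onto `Q`. -/
def LatticeIsomorphic {ι κ : Type*} (P : Set (ι → ℝ)) (Q : Set (κ → ℝ)) : Prop :=
  ∃ f : (ι → ℝ) ≃ᵃ[ℝ] (κ → ℝ), f '' latticePoints ι = latticePoints κ ∧ f '' P = Q

/-- The inner normal cone of `P` along `F`: the functionals which attain their minimum over `P`
at every point of `F`. -/
def normalCone {ι : Type*} (P F : Set (ι → ℝ)) : Set (StrongDual ℝ (ι → ℝ)) :=
  {u | ∀ x ∈ F, ∀ y ∈ P, u x ≤ u y}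

/-- The inner normal fan of a polytope: the set of the normal cones along its nonempty faces. -/
def normalFan {ι : Type*} (P : Set (ι → ℝ)) : Set (Set (StrongDual ℝ (ι → ℝ))) :=
  {σ | ∃ F : Set (ι → ℝ), F.Nonempty ∧ IsExposed ℝ P F ∧ σ = normalCone P F}

/-- The points `0, e_1, …, e_r` of `ℝ^r`. -/
def cayleyVertex {r : ℕ} : Fin (r + 1) → (Fin r → ℝ) :=
  Fin.cases 0 fun j => Pi.single j 1

/-- `[P_0 * ⋯ * P_r]^s = conv (P_0 × 0 ∪ P_1 × s e_1 ∪ ⋯ ∪ P_r × s e_r) ⊆ ℝ^m × ℝ^r`, where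
`ℝ^m × ℝ^r` is written as `Fin m ⊕ Fin r → ℝ`. -/
def cayleySum {m r : ℕ} (s : ℕ) (Q : Fin (r + 1) → Set (Fin m → ℝ)) :
    Set (Fin m ⊕ Fin r → ℝ) :=
  convexHull ℝ (⋃ i, (fun x => Sum.elim x ((s : ℝ) • cayleyVertex i)) '' Q i)

/-- `P ≅ [Q_0 * ⋯ * Q_r]^s` with lattice polytopes `Q_i` of dimension smaller than `dim P`. -/
def IsCayleyDecomposition {n m r : ℕ} (P : Set (Fin n → ℝ)) (s : ℕ)
    (Q : Fin (r + 1) → Set (Fin m → ℝ)) : Prop :=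
  (∀ i, IsLatticePolytope (Q i)) ∧ (∀ i, polytopeDim (Q i) < polytopeDim P) ∧
    LatticeIsomorphic P (cayleySum s Q)

/-- A strict Cayley polytope of order `s`: `P ≅ [Q_0 * ⋯ * Q_r]^s` for some `r` and some lower
dimensional lattice polytopes `Q_0, …, Q_r` which all have the same normal fan. -/
def IsStrictCayleyPolytope {n : ℕ} (P : Set (Fin n → ℝ)) (s : ℕ) : Prop :=
  ∃ (m r : ℕ) (Q : Fin (r + 1) → Set (Fin m → ℝ)),
    IsCayleyDecomposition P s Q ∧ ∀ i j, normalFan (Q i) = normalFan (Q j)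

/-! ### Vertices and edges of polytopes. -/

section Polytope

variable {E : Type*} [NormedAddCommGroup E] [NormedSpace ℝ E]

/-! Smoothness forces `P` to be full-dimensional, so `n ≤ 3`. The last coordinate of the Cayley sum
is a primitive integral height `h` on `P` whose value at every vertex is `0` or `k`. The argument
counts, at each vertex, the slanted edges, those along which `h` changes; primitivity gives at least
one.

If every vertex has exactly one (`IsPrismAt`), the slanted edges pair bottom vertices with top ones.
A functional minimal at one end within its level is minimal at the other end within the other level
(`IsSlab.exists_opposite`). So `P₀` and `P₁` have the same vertex cones, hence the same normal fan,
and the given decomposition is already strict.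

Otherwise some vertex `v`, which may be taken at the bottom, has at least two slanted edges. If all
edges at `v` are slanted, the bottom is `v` alone and the other vertices are its neighbours.
Smoothness of this simplex makes its edges at `v` equally long, and primitivity makes it `k` times a
unimodular simplex: a Cayley sum of `n + 1` points (`IsSlab.strictCayley_of_simplex`). If not, `n =
3` and the bottom is an edge. When every top vertex has just one slanted edge, `P` is a Cayley sum
of three parallel segments (`IsSlab.strictCayley_of_wedge`); when some top vertex has more, `P` is
again a simplex.

All of this is done in lattice coordinates at a vertex (`IsVertexChart`), which rest on the fact
that a polytope lies in the cone spanned by its edges at a vertex (`le_of_forall_exposed_segment`).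
-/

theorem convexHull_extremePoints_of_finite {T : Set E} (hT : T.Finite) :
    convexHull ℝ ((convexHull ℝ T).extremePoints ℝ) = convexHull ℝ T := by
  have h := closure_convexHull_extremePoints (hT.isCompact_convexHull ℝ) (convex_convexHull ℝ T)
  have hfin : ((convexHull ℝ T).extremePoints ℝ).Finite :=
    hT.subset extremePoints_convexHull_subset
  rwa [(hfin.isClosed_convexHull ℝ).closure_eq] at h

/-- A closed convex set containing the extreme points of a compact convex set contains it. -/
theorem subset_of_extremePoints_subset {B C : Set E} (hB : IsCompact B) (hBc : Convex ℝ B)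
    (hC : IsClosed C) (hCc : Convex ℝ C) (h : B.extremePoints ℝ ⊆ C) : B ⊆ C := by
  rw [← closure_convexHull_extremePoints hB hBc]
  exact closure_minimal (convexHull_min h hCc) hC

theorem le_on_convexHull {T : Set E} {f : StrongDual ℝ E} {a : ℝ} (h : ∀ s ∈ T, a ≤ f s) :
    ∀ x ∈ convexHull ℝ T, a ≤ f x := fun _ hx =>
  convexHull_min (t := {x | a ≤ f x}) h (convex_halfSpace_ge f.toLinearMap.isLinear a) hx

theorem exists_dual_lt_of_mem_extremePoints {T : Set E} (hT : T.Finite) {q : E}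
    (hq : q ∈ (convexHull ℝ T).extremePoints ℝ) :
    ∃ l : StrongDual ℝ E, ∀ s ∈ T, s ≠ q → l q < l s := by
  have h1 := ((convex_convexHull ℝ T).mem_extremePoints_iff_mem_sdiff_convexHull_sdiff.1 hq).2
  have h2 : q ∉ convexHull ℝ (T \ {q}) := fun h => h1
    (convexHull_mono (Set.sdiff_subset_sdiff_left (subset_convexHull ℝ T)) h)
  obtain ⟨l, u, hl, hu⟩ := geometric_hahn_banach_point_closed (convex_convexHull ℝ (T \ {q}))
    ((hT.subset Set.sdiff_subset).isClosed_convexHull ℝ) h2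
  exact ⟨l, fun s hs hsq => hl.trans (hu s (subset_convexHull ℝ _ ⟨hs, hsq⟩))⟩

theorem mem_extremePoints_right_of_isExposed_segment {P : Set E} {v w : E}
    (h : IsExposed ℝ P (segment ℝ v w)) : w ∈ P.extremePoints ℝ := by
  refine h.isExtreme.extremePoints_subset_extremePoints ?_
  refine ⟨right_mem_segment ℝ v w, ?_⟩
  rintro x ⟨a, b, ha, hb, hab, rfl⟩ y ⟨c, d, hc, hd, hcd, rfl⟩ ⟨p, q, hp, hq, hpq, hw⟩
  have e : (p * a + q * c) • (w - v) = 0 := by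
    have hb' : b = 1 - a := by linarith
    have hd' : d = 1 - c := by linarith
    have hq' : q = 1 - p := by linarith
    subst hb' hd' hq'
    have hw' : w - (p • (a • v + (1 - a) • w) + (1 - p) • (c • v + (1 - c) • w)) = 0 := by
      rw [hw, sub_self]
    rw [← hw']
    module
  rcases smul_eq_zero.1 e with h0 | h0
  · have : a = 0 := by
      have h1 := mul_nonneg hp.le ha
      have h2 := mul_nonneg hq.le hc
      have h3 : p * a = 0 := by linarith
      exact (mul_eq_zero.1 h3).resolve_left hp.ne'
    subst this
    have : b = 1 := by linarith
    subst this
    simp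
  · have : w = v := sub_eq_zero.1 h0
    subst this
    rw [← add_smul, hab, one_smul]

/-- A functional that does not decrease along the edges of a polytope at the vertex `v` attains its
minimum over the polytope at `v`. -/
theorem le_of_forall_exposed_segment {T : Set E} (hT : T.Finite) {v : E}
    (hv : v ∈ (convexHull ℝ T).extremePoints ℝ) (f : StrongDual ℝ E)
    (hf : ∀ w, w ≠ v → IsExposed ℝ (convexHull ℝ T) (segment ℝ v w) → f v ≤ f w) :
    ∀ x ∈ convexHull ℝ T, f v ≤ f x := by
  obtain ⟨l, hl⟩ := exists_dual_lt_of_mem_extremePoints hT hv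
  set P := convexHull ℝ T with hP
  -- Central projection from `v` to the directions with `l = 1`: the images span the vertex figure,
  -- whose vertices correspond to the edges at `v`.
  set σ : E → E := fun s => (l s - l v)⁻¹ • (s - v) with hσ
  have hσs : ∀ s ∈ T, s ≠ v → s = v + (l s - l v) • σ s := by
    intro s hs hsv
    have : l s - l v ≠ 0 := (sub_pos.2 (hl s hs hsv)).ne'
    simp [hσ, smul_smul, mul_inv_cancel₀ this]
  have hlσ : ∀ s ∈ T, s ≠ v → l (σ s) = 1 := by
    intro s hs hsv
    have : l s - l v ≠ 0 := (sub_pos.2 (hl s hs hsv)).ne'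
    simp [hσ, inv_mul_cancel₀ this]
  have hT' : (σ '' (T \ {v})).Finite := (hT.subset Set.sdiff_subset).image σ
  have key : ∀ q ∈ (convexHull ℝ (σ '' (T \ {v}))).extremePoints ℝ, 0 ≤ f q := by
    intro q hq
    obtain ⟨g, hg⟩ := exists_dual_lt_of_mem_extremePoints hT' hq
    obtain ⟨s₀, ⟨hs₀, hs₀v⟩, hs₀q⟩ := extremePoints_convexHull_subset hq
    -- Of the points of `T` seen from `v` in direction `q`, the farthest is the other end of the
    -- edge.
    obtain ⟨w, ⟨hwT, hwv, hwq⟩, hwmax⟩ :=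
      Set.exists_max_image {s | s ∈ T ∧ s ≠ v ∧ σ s = q} l
        (hT.subset fun s hs => hs.1) ⟨s₀, hs₀, hs₀v, hs₀q⟩
    -- Since `l q = 1`, `F` vanishes on `q`, and it is positive on the other projected directions;
    -- so it is minimal on `P` exactly along the edge.
    set F : StrongDual ℝ E := g - g q • l with hF
    have hFs : ∀ s ∈ T, s ≠ v → F s = F v + (l s - l v) * (g (σ s) - g q) := by
      intro s hs hsv
      have h1 : F s = F (v + (l s - l v) • σ s) := by rw [← hσs s hs hsv]
      rw [h1, map_add, map_smul]
      simp [hF, hlσ s hs hsv]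
    have hFge : ∀ s ∈ T, F v ≤ F s := by
      intro s hs
      by_cases hsv : s = v
      · rw [hsv]
      rw [hFs s hs hsv]
      have h1 := hl s hs hsv
      have h2 : g q ≤ g (σ s) := by
        by_cases h : σ s = q
        · rw [h]
        · exact (hg _ ⟨s, ⟨hs, hsv⟩, rfl⟩ h).le
      nlinarith [mul_nonneg (sub_pos.2 h1).le (sub_nonneg.2 h2)]
    have hFP := le_on_convexHull hFge
    have hFw : F w = F v := by rw [hFs w hwT hwv, hwq]; ring
    have hseg : (-F).toExposed P = segment ℝ v w := by
      have hexp : IsExposed ℝ P ((-F).toExposed P) := ContinuousLinearMap.toExposed.isExposed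
      apply Set.Subset.antisymm
      · refine subset_of_extremePoints_subset (hexp.isCompact (hT.isCompact_convexHull ℝ))
          (hexp.convex (convex_convexHull ℝ T)) ?_ (convex_segment v w) ?_
        · rw [← convexHull_pair]
          exact (Set.toFinite {v, w}).isClosed_convexHull ℝ
        · intro s hs
          have hsT : s ∈ T := extremePoints_convexHull_subset
            (hexp.isExtreme.extremePoints_subset_extremePoints hs)
          by_cases hsv : s = v
          · rw [hsv]; exact left_mem_segment ℝ v w
          have h1 : F s ≤ F v := by simpa using hs.1.2 v hv.1
          have h2 : σ s = q := by
            by_contra h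
            have h3 := hg _ ⟨s, ⟨hsT, hsv⟩, rfl⟩ h
            have h4 := hl s hsT hsv
            rw [hFs s hsT hsv] at h1
            nlinarith [mul_pos (sub_pos.2 h4) (sub_pos.2 h3)]
          have h5 := hwmax s ⟨hsT, hsv, h2⟩
          have h6 := hl s hsT hsv
          have h7 : 0 < l w - l v := by linarith
          rw [segment_eq_image']
          refine ⟨(l s - l v) / (l w - l v), ⟨div_nonneg (by linarith) h7.le, ?_⟩, ?_⟩
          · rw [div_le_one h7]; linarith
          · have e1 := hσs s hsT hsv
            have e2 := hσs w hwT hwv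
            rw [h2] at e1
            rw [hwq] at e2
            have e3 : w - v = (l w - l v) • q := by rw [sub_eq_iff_eq_add']; exact e2
            simp only [e3, smul_smul, div_mul_cancel₀ _ h7.ne']
            exact e1.symm
      · rw [← convexHull_pair]
        refine convexHull_min ?_ (hexp.convex (convex_convexHull ℝ T))
        rintro x (rfl | rfl)
        · exact ⟨hv.1, fun y hy => by simpa using hFP y hy⟩
        · exact ⟨subset_convexHull ℝ T hwT, fun y hy => by simpa [hFw] using hFP y hy⟩
    have h := hf w hwv (by rw [← hseg]; exact ContinuousLinearMap.toExposed.isExposed)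
    have h1 := hl w hwT hwv
    rw [hσs w hwT hwv, hwq, map_add, map_smul, smul_eq_mul] at h
    have h2 : 0 ≤ (l w - l v) * f q := by linarith
    exact nonneg_of_mul_nonneg_right h2 (sub_pos.2 h1)
  have hQ : ∀ q ∈ convexHull ℝ (σ '' (T \ {v})), 0 ≤ f q := by
    rw [← convexHull_extremePoints_of_finite hT']
    exact le_on_convexHull key
  refine le_on_convexHull fun s hs => ?_
  by_cases hsv : s = v
  · rw [hsv]
  have h1 := hl s hs hsv
  have h2 := hQ _ (subset_convexHull ℝ _ ⟨s, ⟨hs, hsv⟩, rfl⟩)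
  rw [hσs s hs hsv, map_add, map_smul, smul_eq_mul]
  have := mul_nonneg (sub_pos.2 h1).le h2
  linarith

end Polytope

/-! ### Lattice charts at the vertices of a smooth polytope. -/

/-- The inclusion of `ℤ^ι` into `ℝ^ι`. -/
def realVec {ι : Type*} : (ι → ℤ) →ₗ[ℤ] (ι → ℝ) where
  toFun z i := (z i : ℝ)
  map_add' x y := by ext; simp
  map_smul' c x := by ext; simp

@[simp] theorem realVec_apply {ι : Type*} (z : ι → ℤ) (i : ι) : realVec z i = (z i : ℝ) := rfl

theorem mem_latticePoints {ι : Type*} {x : ι → ℝ} : x ∈ latticePoints ι ↔ ∃ z, realVec z = x :=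
  Iff.rfl

theorem realVec_injective {ι : Type*} : Function.Injective (realVec (ι := ι)) := by
  intro x y h
  ext i
  have := congrFun h i
  simpa using this

/-- The edge-directions of `P` at `v`, as real vectors. -/
def edgeVectors {ι : Type*} (P : Set (ι → ℝ)) (v : ι → ℝ) : Set (ι → ℝ) :=
  realVec '' edgeDirections P v

/-- The unit vectors are integral combinations of the lattice basis, so these `n` vectors span the
real space and form a basis there. -/
theorem exists_real_basis {n : ℕ} (b : Module.Basis (Fin n) ℤ (Fin n → ℤ)) :
    ∃ c : Module.Basis (Fin n) ℝ (Fin n → ℝ), (∀ i, c i = realVec (b i)) ∧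
      ∀ z i, c.repr (realVec z) i = b.repr z i := by
  have hsum : ∀ z, realVec z = ∑ i, (b.repr z i : ℝ) • realVec (b i) := by
    intro z
    conv_lhs => rw [← b.sum_repr z, map_sum]
    refine Finset.sum_congr rfl fun i _ => ?_
    rw [map_smul, Int.cast_smul_eq_zsmul]
  have hspan : ⊤ ≤ Submodule.span ℝ (Set.range fun i => realVec (b i)) := by
    rw [← (Pi.basisFun ℝ (Fin n)).span_eq, Submodule.span_le]
    rintro _ ⟨i, rfl⟩
    have : (Pi.basisFun ℝ (Fin n)) i = realVec (Pi.single i 1) := by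
      ext j
      by_cases h : j = i
      · subst h; simp
      · simp [h]
    rw [this, hsum]
    exact Submodule.sum_mem _ fun j _ => Submodule.smul_mem _ _ (Submodule.subset_span ⟨j, rfl⟩)
  let c := basisOfTopLeSpanOfCardEqFinrank (fun i => realVec (b i)) hspan (by simp)
  have hc : ∀ i, c i = realVec (b i) := fun i => by
    simp [c]
  refine ⟨c, hc, fun z i => ?_⟩
  rw [hsum z]
  simp_rw [← hc]
  simp [Finsupp.single_apply]

/-- Dividing the integral difference of the endpoints by the gcd of its entries leaves a primitive
vector. -/
theorem exists_edgeDirection {n : ℕ} {P : Set (Fin n → ℝ)} {v w : Fin n → ℝ}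
    (hv : v ∈ latticePoints (Fin n)) (hw : w ∈ latticePoints (Fin n)) (hwv : w ≠ v)
    (h : IsExposed ℝ P (segment ℝ v w)) :
    ∃ d ∈ edgeVectors P v, ∃ t : ℝ, 0 < t ∧ w - v = t • d := by
  obtain ⟨x, rfl⟩ := mem_latticePoints.1 hv
  obtain ⟨y, rfl⟩ := mem_latticePoints.1 hw
  have hxy : y - x ≠ 0 := fun e => hwv (by rw [sub_eq_zero.1 e])
  obtain ⟨i, hi⟩ : ∃ i, (y - x) i ≠ 0 := by
    by_contra! hcon
    exact hxy (funext hcon)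
  obtain ⟨d, hd, hgcd⟩ := Finset.extract_gcd (y - x) (s := Finset.univ) ⟨i, Finset.mem_univ i⟩
  set g := Finset.univ.gcd (y - x) with hg
  have hg0 : g ≠ 0 := fun e => hi (Finset.gcd_eq_zero_iff.1 e i (Finset.mem_univ i))
  have hgpos : 0 < g :=
    lt_of_le_of_ne (Int.nonneg_of_normalize_eq_self Finset.normalize_gcd) (Ne.symm hg0)
  have hgd : y - x = g • d := by
    ext j
    rw [hd j (Finset.mem_univ j)]
    simp
  have ht : realVec y - realVec x = (g : ℝ) • realVec d := by
    rw [← map_sub, hgd, map_smul, Int.cast_smul_eq_zsmul]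
  refine ⟨realVec d, ⟨d, ⟨?_, realVec y, hwv, h, g, by exact_mod_cast hgpos, ht⟩, rfl⟩, g,
    by exact_mod_cast hgpos, ht⟩
  intro c d' hdd
  have : c ∣ Finset.univ.gcd d := Finset.dvd_gcd fun j _ => ⟨d' j, by rw [hdd]; rfl⟩
  rw [hgcd] at this
  exact isUnit_of_dvd_one this

theorem neg_mem_edgeVectors {ι : Type*} {P : Set (ι → ℝ)} {v w d : ι → ℝ} {t : ℝ}
    (hd : d ∈ edgeVectors P v) (ht : 0 < t) (h : IsExposed ℝ P (segment ℝ v w))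
    (hw : w - v = t • d) : -d ∈ edgeVectors P w := by
  obtain ⟨d, hd, rfl⟩ := hd
  refine ⟨-d, ⟨?_, v, ?_, by rwa [segment_symm], t, ht, ?_⟩, map_neg _ _⟩
  · intro c d' hdd
    exact hd.1 c (-d') (by rw [smul_neg, ← hdd, neg_neg])
  · rintro rfl
    rw [sub_self, eq_comm, smul_eq_zero] at hw
    rcases hw with hw | hw
    · exact ht.ne' hw
    · have : d = 0 := realVec_injective (by rw [hw, map_zero])
      have := hd.1 0 0 (by simpa using this)
      exact not_isUnit_zero this
  · change v - w = t • realVec (-d)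
    rw [map_neg, smul_neg, ← hw, neg_sub]

/-- The local structure of a smooth polytope at the vertex `v`: a lattice basis `b` of the
edge-directions at `v`, where `v + t i • b i` is the other end of the `i`-th edge. -/
structure IsVertexChart {n : ℕ} (P : Set (Fin n → ℝ)) (v : Fin n → ℝ)
    (b : Module.Basis (Fin n) ℝ (Fin n → ℝ)) (t : Fin n → ℝ) : Prop where
  lattice : ∀ x, x ∈ latticePoints (Fin n) ↔ ∀ i, ∃ z : ℤ, b.repr x i = z
  pos : ∀ i, 0 < t i
  nbr : ∀ i, v + t i • b i ∈ P.extremePoints ℝ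
  cone : ∀ x ∈ P, ∀ i, 0 ≤ b.repr (x - v) i
  edges : ∀ d ∈ edgeVectors P v, ∃ i, b i = d
  rev : ∀ i, -b i ∈ edgeVectors P (v + t i • b i)

theorem IsLatticePolytope.extremePoints_subset {ι : Type*} [Fintype ι] {P : Set (ι → ℝ)}
    (hP : IsLatticePolytope P) : P.extremePoints ℝ ⊆ latticePoints ι := by
  obtain ⟨S, -, -, hS, rfl⟩ := hP
  exact extremePoints_convexHull_subset.trans hS

theorem IsLatticePolytope.finite_extremePoints {ι : Type*} [Fintype ι] {P : Set (ι → ℝ)}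
    (hP : IsLatticePolytope P) : (P.extremePoints ℝ).Finite := by
  obtain ⟨S, hS, -, -, rfl⟩ := hP
  exact hS.subset extremePoints_convexHull_subset

theorem IsLatticePolytope.convexHull_extremePoints {ι : Type*} [Fintype ι] {P : Set (ι → ℝ)}
    (hP : IsLatticePolytope P) : convexHull ℝ (P.extremePoints ℝ) = P := by
  obtain ⟨S, hS, -, -, rfl⟩ := hP
  exact convexHull_extremePoints_of_finite hS

theorem IsLatticePolytope.convex {ι : Type*} {P : Set (ι → ℝ)}
    (hP : IsLatticePolytope P) : Convex ℝ P := by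
  obtain ⟨S, -, -, -, rfl⟩ := hP
  exact convex_convexHull ℝ S

theorem IsLatticePolytope.isCompact {ι : Type*} [Fintype ι] {P : Set (ι → ℝ)}
    (hP : IsLatticePolytope P) : IsCompact P := by
  obtain ⟨S, hS, -, -, rfl⟩ := hP
  exact hS.isCompact_convexHull ℝ

theorem IsLatticePolytope.nonempty {ι : Type*} {P : Set (ι → ℝ)}
    (hP : IsLatticePolytope P) : P.Nonempty := by
  obtain ⟨S, -, hS, -, rfl⟩ := hP
  exact hS.convexHull

theorem IsLatticePolytope.exists_extremePoint {ι : Type*} [Fintype ι] {P : Set (ι → ℝ)}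
    (hP : IsLatticePolytope P) : (P.extremePoints ℝ).Nonempty :=
  hP.isCompact.extremePoints_nonempty hP.nonempty

theorem IsSmoothPolytope.exists_vertexChart {n : ℕ} {P : Set (Fin n → ℝ)}
    (hP : IsSmoothPolytope P) {v : Fin n → ℝ} (hv : v ∈ P.extremePoints ℝ) :
    ∃ b t, IsVertexChart P v b t := by
  obtain ⟨hli, hspan⟩ := hP.2 v hv
  let e := Module.Basis.mk hli (by rw [Subtype.range_coe_subtype, Set.ofPred_mem_eq, hspan])
  let b := e.reindex (e.indexEquiv (Pi.basisFun ℤ (Fin n)))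
  have hb : ∀ i, b i ∈ edgeDirections P v := by
    intro i
    simp [b, e]
  have hb' : ∀ d ∈ edgeDirections P v, ∃ i, b i = d := by
    intro d hd
    exact ⟨(e.indexEquiv (Pi.basisFun ℤ (Fin n))) ⟨d, hd⟩, by simp [b, e]⟩
  obtain ⟨c, hc, hcz⟩ := exists_real_basis b
  have hw : ∀ i, ∃ t : ℝ, 0 < t ∧ IsExposed ℝ P (segment ℝ v (v + t • c i)) := by
    intro i
    obtain ⟨w, -, hw, t, ht, htw⟩ := (hb i).2
    refine ⟨t, ht, ?_⟩
    have : w = v + t • c i := by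
      rw [hc, ← sub_eq_iff_eq_add']; exact htw
    rwa [← this]
  choose t ht hexp using hw
  have hedge : ∀ d ∈ edgeVectors P v, ∃ i, c i = d := by
    rintro _ ⟨d, hd, rfl⟩
    obtain ⟨i, rfl⟩ := hb' d hd
    exact ⟨i, hc i⟩
  refine ⟨c, t, ⟨?_, ht, fun i => mem_extremePoints_right_of_isExposed_segment (hexp i), ?_, hedge,
    fun i => ?_⟩⟩
  · intro x
    constructor
    · rintro ⟨z, rfl⟩ i
      exact ⟨b.repr z i, hcz z i⟩
    · intro h
      choose z hz using h
      refine ⟨∑ i, z i • b i, ?_⟩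
      change realVec _ = x
      rw [map_sum, ← c.sum_repr x]
      refine Finset.sum_congr rfl fun i _ => ?_
      rw [map_smul, hz, hc, Int.cast_smul_eq_zsmul]
  · intro x hx i
    have hPl := hP.1
    obtain ⟨S, hS, -, -, rfl⟩ := hP.1
    -- A coordinate functional takes only the values `0` and `1` on the edge-directions at `v`, so
    -- it is minimal over `P` at `v`.
    have := le_of_forall_exposed_segment hS hv (LinearMap.toContinuousLinearMap (c.coord i)) ?_ x hx
    · simpa [sub_nonneg] using this
    · intro w hwv hw
      obtain ⟨d, hd, s, hs, hsd⟩ := exists_edgeDirection (hPl.extremePoints_subset hv)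
        (hPl.extremePoints_subset (mem_extremePoints_right_of_isExposed_segment hw)) hwv hw
      obtain ⟨j, rfl⟩ := hedge d hd
      rw [sub_eq_iff_eq_add'] at hsd
      subst hsd
      simp only [LinearMap.coe_toContinuousLinearMap', map_add, map_smul, smul_eq_mul,
        le_add_iff_nonneg_right]
      refine mul_nonneg hs.le ?_
      simp only [Module.Basis.coord_apply, Module.Basis.repr_self, Finsupp.single_apply]
      split_ifs <;> simp
  · exact neg_mem_edgeVectors ⟨b i, hb i, (hc i).symm⟩ (ht i) (hexp i) (by simp)

/-! ### Normal fans from vertex cones. -/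

theorem mem_normalCone_singleton {ι : Type*} {Q : Set (ι → ℝ)} {v : ι → ℝ}
    {u : StrongDual ℝ (ι → ℝ)} : u ∈ normalCone Q {v} ↔ ∀ y ∈ Q, u v ≤ u y := by
  simp [normalCone]

/-- The normal cone along the face where `u` is minimal, in terms of the normal cones at points
of a set `V` containing all vertices. -/
theorem mem_normalCone_toExposed_iff {ι : Type*} [Fintype ι] {Q V : Set (ι → ℝ)} (hQ : IsCompact Q)
    (hQc : Convex ℝ Q) (hV : Q.extremePoints ℝ ⊆ V) (hVQ : V ⊆ Q) (u w : StrongDual ℝ (ι → ℝ)) :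
    w ∈ normalCone Q ((-u).toExposed Q) ↔
      ∀ v ∈ V, u ∈ normalCone Q {v} → w ∈ normalCone Q {v} := by
  have hexp : IsExposed ℝ Q ((-u).toExposed Q) := ContinuousLinearMap.toExposed.isExposed
  constructor
  · intro hw v hv huv
    rw [mem_normalCone_singleton] at huv ⊢
    exact hw v ⟨hVQ hv, fun y hy => by simpa using huv y hy⟩
  · intro h
    have hclosed : IsClosed {x | ∀ y ∈ Q, w x ≤ w y} := by
      simp only [Set.ofPred_forall]
      exact isClosed_biInter fun y _ => isClosed_le w.continuous continuous_const
    have hconv : Convex ℝ {x | ∀ y ∈ Q, w x ≤ w y} := by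
      simp only [Set.ofPred_forall]
      exact convex_iInter₂ fun y _ => convex_halfSpace_le w.toLinearMap.isLinear _
    refine subset_of_extremePoints_subset (hexp.isCompact hQ) (hexp.convex hQc) hclosed hconv ?_
    intro v hv
    have h1 := h v (hV (hexp.isExtreme.extremePoints_subset_extremePoints hv))
      (mem_normalCone_singleton.2 fun y hy => by simpa using hv.1.2 y hy)
    exact mem_normalCone_singleton.1 h1

/-- By `mem_normalCone_toExposed_iff`, the cone of a face is the intersection of the vertex cones
containing a functional that cuts it out, so the vertex cones determine the fan. Exposed faces
maximise while normal cones minimise, hence the `-l`. -/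
theorem normalFan_subset_of_vertexCones {ι : Type*} [Fintype ι] {Q Q' V V' : Set (ι → ℝ)}
    (hQ : IsCompact Q) (hQc : Convex ℝ Q) (hV : Q.extremePoints ℝ ⊆ V) (hVQ : V ⊆ Q)
    (hQ' : IsCompact Q') (hQc' : Convex ℝ Q') (hV' : Q'.extremePoints ℝ ⊆ V') (hVQ' : V' ⊆ Q')
    (hne : Q'.Nonempty)
    (h : ∀ v ∈ V, ∃ w ∈ V', normalCone Q {v} = normalCone Q' {w})
    (h' : ∀ w ∈ V', ∃ v ∈ V, normalCone Q {v} = normalCone Q' {w}) :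
    normalFan Q ⊆ normalFan Q' := by
  rintro σ ⟨F, hF, hexp, rfl⟩
  obtain ⟨l, rfl⟩ := hexp hF
  obtain ⟨x, hx, hmin⟩ := hQ'.exists_isMaxOn hne l.continuous.continuousOn
  refine ⟨l.toExposed Q', ⟨x, hx, hmin⟩, ContinuousLinearMap.toExposed.isExposed, ?_⟩
  have e1 := mem_normalCone_toExposed_iff hQ hQc hV hVQ (-l)
  have e2 := mem_normalCone_toExposed_iff hQ' hQc' hV' hVQ' (-l)
  rw [neg_neg] at e1 e2
  ext w
  refine (e1 w).trans (Iff.trans ⟨fun H y hy => ?_, fun H y hy => ?_⟩ (e2 w).symm)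
  · obtain ⟨v, hv, hvy⟩ := h' y hy
    rw [← hvy]
    exact H v hv
  · obtain ⟨v, hv, hvy⟩ := h y hy
    rw [hvy]
    exact H v hv

theorem normalFan_eq_of_vertexCones {ι : Type*} [Fintype ι] {Q Q' V V' : Set (ι → ℝ)}
    (hQ : IsLatticePolytope Q) (hV : Q.extremePoints ℝ ⊆ V) (hVQ : V ⊆ Q)
    (hQ' : IsLatticePolytope Q') (hV' : Q'.extremePoints ℝ ⊆ V') (hVQ' : V' ⊆ Q')
    (h : ∀ v ∈ V, ∃ w ∈ V', normalCone Q {v} = normalCone Q' {w})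
    (h' : ∀ w ∈ V', ∃ v ∈ V, normalCone Q {v} = normalCone Q' {w}) :
    normalFan Q = normalFan Q' := by
  refine (normalFan_subset_of_vertexCones hQ.isCompact hQ.convex hV hVQ hQ'.isCompact hQ'.convex
    hV' hVQ' hQ'.nonempty h h').antisymm
    (normalFan_subset_of_vertexCones hQ'.isCompact hQ'.convex hV' hVQ' hQ.isCompact hQ.convex
    hV hVQ hQ.nonempty (fun v hv => ?_) fun v hv => ?_)
  · obtain ⟨w, hw, e⟩ := h' v hv
    exact ⟨w, hw, e.symm⟩
  · obtain ⟨w, hw, e⟩ := h v hv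
    exact ⟨w, hw, e.symm⟩

/-- The normal cone at the left end of a segment. -/
theorem normalCone_least {Q : Set (Fin 1 → ℝ)} (hQ : Q.Nontrivial) {v : Fin 1 → ℝ}
    (hle : ∀ y ∈ Q, v 0 ≤ y 0) : normalCone Q {v} = {u | 0 ≤ u 1} := by
  have hu : ∀ (u : StrongDual ℝ (Fin 1 → ℝ)) (x : Fin 1 → ℝ), u x = x 0 * u 1 := by
    intro u x
    have : x = x 0 • 1 := by ext i; simp [Fin.fin_one_eq_zero i]
    conv_lhs => rw [this, map_smul, smul_eq_mul]
  ext u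
  rw [mem_normalCone_singleton]
  constructor
  · intro h
    obtain ⟨y, hy, hyv⟩ := hQ.exists_ne v
    have h1 := h y hy
    have h2 : v 0 ≠ y 0 := fun e => hyv (funext fun i => by rw [Fin.fin_one_eq_zero i, e])
    rw [hu u v, hu u y] at h1
    have h3 : 0 < y 0 - v 0 := sub_pos.2 (lt_of_le_of_ne (hle y hy) h2)
    exact nonneg_of_mul_nonneg_right (by linarith : 0 ≤ (y 0 - v 0) * u 1) h3
  · intro h y hy
    rw [hu u v, hu u y]
    exact mul_le_mul_of_nonneg_right (hle y hy) h

theorem normalCone_greatest {Q : Set (Fin 1 → ℝ)} (hQ : Q.Nontrivial) {v : Fin 1 → ℝ}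
    (hle : ∀ y ∈ Q, y 0 ≤ v 0) : normalCone Q {v} = {u | u 1 ≤ 0} := by
  have hu : ∀ (u : StrongDual ℝ (Fin 1 → ℝ)) (x : Fin 1 → ℝ), u x = x 0 * u 1 := by
    intro u x
    have : x = x 0 • 1 := by ext i; simp [Fin.fin_one_eq_zero i]
    conv_lhs => rw [this, map_smul, smul_eq_mul]
  ext u
  rw [mem_normalCone_singleton]
  constructor
  · intro h
    obtain ⟨y, hy, hyv⟩ := hQ.exists_ne v
    have h1 := h y hy
    have h2 : y 0 ≠ v 0 := fun e => hyv (funext fun i => by rw [Fin.fin_one_eq_zero i, e])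
    rw [hu u v, hu u y] at h1
    have h3 : 0 < v 0 - y 0 := sub_pos.2 (lt_of_le_of_ne (hle y hy) h2)
    exact nonpos_of_mul_nonpos_right (by linarith : (v 0 - y 0) * u 1 ≤ 0) h3
  · intro h y hy
    rw [hu u v, hu u y]
    exact mul_le_mul_of_nonpos_right (hle y hy) h

theorem extremePoints_line {Q : Set (Fin 1 → ℝ)} :
    Q.extremePoints ℝ ⊆ {v ∈ Q | (∀ y ∈ Q, v 0 ≤ y 0) ∨ ∀ y ∈ Q, y 0 ≤ v 0} := by
  intro v hv
  refine ⟨hv.1, ?_⟩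
  by_contra! h
  obtain ⟨⟨a, ha, hav⟩, b, hb, hvb⟩ := h
  have hab : 0 < b 0 - a 0 := by linarith
  have h1 : a = v := by
    refine hv.2 ha hb ?_
    refine ⟨(b 0 - v 0) / (b 0 - a 0), (v 0 - a 0) / (b 0 - a 0), div_pos (by linarith) hab,
      div_pos (by linarith) hab, by field_simp; ring, ?_⟩
    ext i
    rw [Fin.fin_one_eq_zero i]
    simp
    field_simp
    ring
  rw [h1] at hav
  exact lt_irrefl _ hav

/-- All nondegenerate segments on the line have the same normal fan. -/
theorem normalFan_segment_eq {Q Q' : Set (Fin 1 → ℝ)} (hQ : IsLatticePolytope Q)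
    (hQ' : IsLatticePolytope Q') (hn : Q.Nontrivial) (hn' : Q'.Nontrivial) :
    normalFan Q = normalFan Q' := by
  have key : ∀ {Q Q' : Set (Fin 1 → ℝ)}, IsLatticePolytope Q' → Q.Nontrivial → Q'.Nontrivial →
      ∀ v ∈ {v ∈ Q | (∀ y ∈ Q, v 0 ≤ y 0) ∨ ∀ y ∈ Q, y 0 ≤ v 0},
      ∃ w ∈ {v ∈ Q' | (∀ y ∈ Q', v 0 ≤ y 0) ∨ ∀ y ∈ Q', y 0 ≤ v 0},
        normalCone Q {v} = normalCone Q' {w} := by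
    rintro Q Q' hQ' hn hn' v ⟨hv, h | h⟩
    · obtain ⟨w, hw, hmin⟩ := hQ'.isCompact.exists_isMinOn hQ'.nonempty
        (continuous_apply (0 : Fin 1)).continuousOn
      exact ⟨w, ⟨hw, Or.inl hmin⟩, by
        rw [normalCone_least hn h, normalCone_least hn' hmin]⟩
    · obtain ⟨w, hw, hmax⟩ := hQ'.isCompact.exists_isMaxOn hQ'.nonempty
        (continuous_apply (0 : Fin 1)).continuousOn
      exact ⟨w, ⟨hw, Or.inr hmax⟩, by
        rw [normalCone_greatest hn h, normalCone_greatest hn' hmax]⟩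
  refine normalFan_eq_of_vertexCones hQ extremePoints_line (Set.sep_subset _ _) hQ'
    extremePoints_line (Set.sep_subset _ _) (key hQ' hn hn') fun w hw => ?_
  obtain ⟨v, hv, e⟩ := key hQ hn' hn w hw
  exact ⟨v, hv, e.symm⟩

/-! ### Full dimension, and recognising Cayley sums in coordinates. -/

theorem IsVertexChart.polytopeDim_eq {n : ℕ} {P : Set (Fin n → ℝ)} {v : Fin n → ℝ}
    {b : Module.Basis (Fin n) ℝ (Fin n → ℝ)} {t : Fin n → ℝ} (hv : v ∈ P.extremePoints ℝ)
    (hc : IsVertexChart P v b t) : polytopeDim P = n := by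
  have h : vectorSpan ℝ P = ⊤ := by
    rw [eq_top_iff, ← b.span_eq, Submodule.span_le]
    rintro _ ⟨i, rfl⟩
    have h1 : (v + t i • b i) -ᵥ v ∈ vectorSpan ℝ P := vsub_mem_vectorSpan ℝ (hc.nbr i).1 hv.1
    rw [vsub_eq_sub, add_sub_cancel_left] at h1
    have h2 := Submodule.smul_mem _ (t i)⁻¹ h1
    rwa [smul_smul, inv_mul_cancel₀ (hc.pos i).ne', one_smul] at h2
  rw [polytopeDim, h, finrank_top, Module.finrank_fin_fun]

theorem IsSmoothPolytope.polytopeDim_eq {n : ℕ} {P : Set (Fin n → ℝ)} (hP : IsSmoothPolytope P) :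
    polytopeDim P = n := by
  obtain ⟨v, hv⟩ := hP.1.exists_extremePoint
  obtain ⟨b, t, hc⟩ := hP.exists_vertexChart hv
  exact hc.polytopeDim_eq hv

theorem sub_mem_latticePoints {ι : Type*} {x y : ι → ℝ} (hx : x ∈ latticePoints ι)
    (hy : y ∈ latticePoints ι) : x - y ∈ latticePoints ι := by
  obtain ⟨x, rfl⟩ := hx
  obtain ⟨y, rfl⟩ := hy
  exact ⟨x - y, map_sub realVec x y⟩

theorem add_mem_latticePoints {ι : Type*} {x y : ι → ℝ} (hx : x ∈ latticePoints ι)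
    (hy : y ∈ latticePoints ι) : x + y ∈ latticePoints ι := by
  obtain ⟨x, rfl⟩ := hx
  obtain ⟨y, rfl⟩ := hy
  exact ⟨x + y, map_add realVec x y⟩

/-- The first coordinates of the vertices of `P` whose last coordinates, in the lattice basis `b`
with origin `v`, are those of the `i`-th vertex of the `k`-fold standard simplex. -/
def cayleyFiber {n m r : ℕ} (P : Set (Fin n → ℝ)) (b : Module.Basis (Fin m ⊕ Fin r) ℝ (Fin n → ℝ))
    (v : Fin n → ℝ) (k : ℕ) (i : Fin (r + 1)) : Set (Fin m → ℝ) :=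
  (fun x j => b.repr (x - v) (Sum.inl j)) ''
    {x ∈ P.extremePoints ℝ | ∀ j, b.repr (x - v) (Sum.inr j) = k * cayleyVertex i j}

section Recognition

variable {n m r k : ℕ} {P : Set (Fin n → ℝ)} {b : Module.Basis (Fin m ⊕ Fin r) ℝ (Fin n → ℝ)}
  {v : Fin n → ℝ}

theorem isLatticePolytope_cayleyFiber (hP : IsLatticePolytope P)
    (hb : ∀ x, x ∈ latticePoints (Fin n) ↔ ∀ i, ∃ z : ℤ, b.repr x i = z)
    (hv : v ∈ latticePoints (Fin n)) (i : Fin (r + 1))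
    (hne : ∃ x ∈ P.extremePoints ℝ, ∀ j, b.repr (x - v) (Sum.inr j) = k * cayleyVertex i j) :
    IsLatticePolytope (convexHull ℝ (cayleyFiber P b v k i)) := by
  refine ⟨_, (hP.finite_extremePoints.subset (Set.sep_subset _ _)).image _, ?_, ?_, rfl⟩
  · obtain ⟨x, hx, h⟩ := hne
    exact ⟨_, x, ⟨hx, h⟩, rfl⟩
  · rintro _ ⟨x, ⟨hx, -⟩, rfl⟩
    have h := (hb _).1 (sub_mem_latticePoints (hP.extremePoints_subset hx) hv)
    choose z hz using h
    exact ⟨fun j => z (Sum.inl j), funext fun j => (hz _).symm⟩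

/-- The chart centred at `v` is itself the required lattice isomorphism, so only the last `r`
coordinates of the vertices and the fans of the fibres need checking. The fibres live in dimension
`m = n - r`, so `0 < r` makes them lower-dimensional. -/
theorem isStrictCayleyPolytope_of_coordinates (hP : IsSmoothPolytope P) (hr : 0 < r)
    (hb : ∀ x, x ∈ latticePoints (Fin n) ↔ ∀ i, ∃ z : ℤ, b.repr x i = z)
    (hv : v ∈ latticePoints (Fin n))
    (hcoord : ∀ x ∈ P.extremePoints ℝ, ∃ i : Fin (r + 1),
      ∀ j, b.repr (x - v) (Sum.inr j) = k * cayleyVertex i j)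
    (hne : ∀ i : Fin (r + 1), ∃ x ∈ P.extremePoints ℝ,
      ∀ j, b.repr (x - v) (Sum.inr j) = k * cayleyVertex i j)
    (hfan : ∀ i j, normalFan (convexHull ℝ (cayleyFiber P b v k i)) =
      normalFan (convexHull ℝ (cayleyFiber P b v k j))) :
    IsStrictCayleyPolytope P k := by
  refine ⟨m, r, fun i => convexHull ℝ (cayleyFiber P b v k i),
    ⟨fun i => isLatticePolytope_cayleyFiber hP.1 hb hv i (hne i), fun i => ?_, ?_⟩, hfan⟩
  · rw [hP.polytopeDim_eq]
    have h1 : n = m + r := by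
      have := Module.finrank_eq_card_basis b
      simpa using this
    have h2 := (vectorSpan ℝ (convexHull ℝ (cayleyFiber P b v k i))).finrank_le
    rw [Module.finrank_fin_fun] at h2
    exact lt_of_le_of_lt h2 (by omega)
  · let f : (Fin n → ℝ) ≃ᵃ[ℝ] (Fin m ⊕ Fin r → ℝ) :=
      (AffineEquiv.constVAdd ℝ (Fin n → ℝ) (-v)).trans b.equivFun.toAffineEquiv
    have hf : ∀ x i, f x i = b.repr (x - v) i := by
      intro x i
      simp [f, neg_add_eq_sub]
    have hfin : ∀ x : Fin m ⊕ Fin r → ℝ, ∃ y, f y = x := f.surjective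
    refine ⟨f, ?_, ?_⟩
    · ext y
      constructor
      · rintro ⟨x, hx, rfl⟩
        have h := (hb _).1 (sub_mem_latticePoints hx hv)
        choose z hz using h
        exact ⟨z, funext fun i => by rw [hf, hz]⟩
      · rintro ⟨z, rfl⟩
        obtain ⟨x, hx⟩ := hfin (realVec z)
        refine ⟨x, ?_, hx⟩
        have h1 : x - v ∈ latticePoints (Fin n) := by
          rw [hb]
          intro i
          exact ⟨z i, by rw [← hf, hx]; rfl⟩
        simpa using add_mem_latticePoints h1 hv
    · have himg : f '' P = convexHull ℝ (f '' P.extremePoints ℝ) := by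
        conv_lhs => rw [← hP.1.convexHull_extremePoints]
        exact f.toAffineMap.image_convexHull _
      have hfx : ∀ x i, (∀ j, b.repr (x - v) (Sum.inr j) = k * cayleyVertex i j) →
          f x = Sum.elim (fun j => b.repr (x - v) (Sum.inl j)) ((k : ℝ) • cayleyVertex i) := by
        intro x i hx
        ext (j | j)
        · simp [hf]
        · rw [hf, hx]; rfl
      rw [himg, cayleySum]
      apply Set.Subset.antisymm
      · refine convexHull_mono ?_
        rintro _ ⟨x, hx, rfl⟩
        obtain ⟨i, hi⟩ := hcoord x hx
        refine Set.mem_iUnion.2 ⟨i, _, subset_convexHull ℝ _ ⟨x, ⟨hx, hi⟩, rfl⟩, (hfx x i hi).symm⟩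
      · refine convexHull_min (Set.iUnion_subset fun i => ?_) (convex_convexHull ℝ _)
        rintro _ ⟨y, hy, rfl⟩
        have hconv : Convex ℝ {y : Fin m → ℝ | Sum.elim y ((k : ℝ) • cayleyVertex i) ∈
            convexHull ℝ (f '' P.extremePoints ℝ)} := by
          intro x hx y hy p q hp hq hpq
          have := convex_convexHull ℝ (f '' P.extremePoints ℝ) hx hy hp hq hpq
          rw [Set.mem_ofPred_eq]
          convert this using 1
          ext (j | j)
          · simp
          · simp only [Sum.elim_inr, Pi.add_apply, Pi.smul_apply, smul_eq_mul]
            rw [← add_mul, hpq, one_mul]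
        refine convexHull_min ?_ hconv hy
        rintro _ ⟨x, ⟨hx, hi⟩, rfl⟩
        exact subset_convexHull ℝ _ ⟨x, hx, hfx x i hi⟩

end Recognition

/-! ### Edge lengths of a smooth simplex. -/

section Simplex

variable {n : ℕ} {P : Set (Fin n → ℝ)} {v : Fin n → ℝ}
  {b : Module.Basis (Fin n) ℝ (Fin n → ℝ)} {t : Fin n → ℝ}

theorem IsVertexChart.basis_mem (hc : IsVertexChart P v b t) (i : Fin n) :
    b i ∈ latticePoints (Fin n) := by
  rw [hc.lattice]
  intro j
  rw [b.repr_self, Finsupp.single_apply]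
  split_ifs
  · exact ⟨1, by simp⟩
  · exact ⟨0, by simp⟩

/-- In a smooth simplex all edges at a vertex have the same lattice length: one inequality. -/
theorem IsVertexChart.length_le_of_simplex (hc : IsVertexChart P v b t) (hP : IsSmoothPolytope P)
    (hsimp : ∀ x ∈ P.extremePoints ℝ, x = v ∨ ∃ i, x = v + t i • b i) (i j : Fin n) :
    t j ≤ t i := by
  by_cases hij : i = j
  · rw [hij]
  obtain ⟨c, s, hc'⟩ := hP.exists_vertexChart (hc.nbr i)
  -- An edge at the `i`-th neighbour that moves the `j`-th coordinate can only lead to the `j`-th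
  -- neighbour.
  have hend : ∀ l, b.repr (c l) j ≠ 0 → s l • c l = t j • b j - t i • b i := by
    intro l hl
    have hcl := hc'.pos l
    rcases hsimp _ (hc'.nbr l) with h | ⟨m, h⟩
    · exfalso
      have h1 : s l • c l = - (t i • b i) := by
        rw [add_assoc] at h
        exact eq_neg_of_add_eq_zero_right (left_eq_add.1 h.symm)
      have h2 := congrArg (fun x => b.repr x j) h1
      simp [hij, hcl.ne', hl] at h2
    · have h1 : s l • c l = t m • b m - t i • b i := by
        rw [add_assoc] at h
        rw [eq_sub_iff_add_eq']
        exact add_left_cancel h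
      by_cases hm : m = j
      · rw [hm] at h1; exact h1
      exfalso
      have h2 := congrArg (fun x => b.repr x j) h1
      simp [hij, hm, hcl.ne', hl] at h2
  have hsum : ∑ l, c.repr (b j) l * b.repr (c l) j = 1 := by
    have h := congrArg (fun x => b.coord j x) (c.sum_repr (b j))
    simp only [map_sum, map_smul, smul_eq_mul, Module.Basis.coord_apply] at h
    rw [h, b.repr_self, Finsupp.single_eq_same]
  obtain ⟨l, -, hl⟩ := Finset.exists_ne_zero_of_sum_ne_zero (hsum.trans_ne one_ne_zero)
  have hl0 : b.repr (c l) j ≠ 0 := right_ne_zero_of_mul hl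
  -- Two such edges would have the same endpoint, hence be parallel, although they belong to a
  -- basis.
  have huniq : ∀ l', l' ≠ l → b.repr (c l') j = 0 := by
    intro l' hne
    by_contra h
    have h1 := congrArg (fun x => c.repr x l) ((hend l' h).trans (hend l hl0).symm)
    simp [hne, (hc'.pos l).ne] at h1
  rw [Finset.sum_eq_single l (fun l' _ h => by rw [huniq l' h, mul_zero]) (by simp)] at hsum
  have e := hend l hl0
  have ej := congrArg (fun x => b.repr x j) e
  have ei := congrArg (fun x => b.repr x i) e
  simp [hij] at ej
  simp [Ne.symm hij] at ei
  -- In integers `z * a = 1` with `a > 0`, so `a = 1` and this edge has length `s l = t j`. Its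
  -- `i`-th coordinate gives `t i = s l * (-d)` with `-d ≥ 1`, which is the inequality.
  obtain ⟨z, hz⟩ := (hc'.lattice _).1 (hc.basis_mem j) l
  obtain ⟨a, ha⟩ := (hc.lattice _).1 (hc'.basis_mem l) j
  obtain ⟨d, hd⟩ := (hc.lattice _).1 (hc'.basis_mem l) i
  rw [hz, ha] at hsum
  rw [ha] at ej
  rw [hd] at ei
  have hsl := hc'.pos l
  have hti := hc.pos i
  have htj := hc.pos j
  have ha0 : 0 < (a : ℝ) := pos_of_mul_pos_right (ej ▸ htj) hsl.le
  have ha0' : 0 < a := by exact_mod_cast ha0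
  have hza : z * a = 1 := by exact_mod_cast hsum
  have ha1 : a = 1 := by
    have := Int.isUnit_iff.1 (IsUnit.of_mul_eq_one_right z hza)
    omega
  subst ha1
  have hd0 : 0 < ((-d : ℤ) : ℝ) := by
    push_cast
    refine pos_of_mul_pos_right (a := s l) ?_ hsl.le
    linarith
  have hd1 : (1 : ℝ) ≤ ((-d : ℤ) : ℝ) := by
    have : 0 < -d := by exact_mod_cast hd0
    exact_mod_cast this
  push_cast at hd1 ej
  nlinarith

end Simplex

/-! ### Slabs: smooth polytopes with two vertex heights. -/

/-- `h` is a primitive integral affine function which takes only the values `0` and `k` at the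
vertices of the smooth polytope `P`. -/
structure IsSlab {n : ℕ} (P : Set (Fin n → ℝ)) (h : (Fin n → ℝ) →ᵃ[ℝ] ℝ) (k : ℕ) : Prop where
  smooth : IsSmoothPolytope P
  pos : 0 < k
  int : ∀ x ∈ latticePoints (Fin n), ∃ z : ℤ, h.linear x = z
  prim : ∃ x ∈ latticePoints (Fin n), h.linear x = 1
  vert : ∀ x ∈ P.extremePoints ℝ, h x = 0 ∨ h x = k

/-- Exactly one edge of a chart is slanted, i.e. not horizontal for `h`. -/
def IsPrismAt {n : ℕ} (h : (Fin n → ℝ) →ᵃ[ℝ] ℝ) (b : Module.Basis (Fin n) ℝ (Fin n → ℝ)) : Prop :=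
  ∃ i, h.linear (b i) ≠ 0 ∧ ∀ l, l ≠ i → h.linear (b l) = 0

theorem cayleyVertex_zero {r : ℕ} : cayleyVertex (0 : Fin (r + 1)) = 0 := rfl

theorem cayleyVertex_succ {r : ℕ} (i : Fin r) : cayleyVertex i.succ = Pi.single i 1 := rfl

section Slab

variable {n k : ℕ} {P : Set (Fin n → ℝ)} {h : (Fin n → ℝ) →ᵃ[ℝ] ℝ} {v : Fin n → ℝ}
  {b : Module.Basis (Fin n) ℝ (Fin n → ℝ)} {t : Fin n → ℝ}

/-- Turning the slab upside down lets results about bottom vertices serve for top vertices. -/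
theorem IsSlab.flip (hs : IsSlab P h k) : IsSlab P (AffineMap.const ℝ _ (k : ℝ) - h) k := by
  refine ⟨hs.smooth, hs.pos, fun x hx => ?_, ?_, fun x hx => ?_⟩
  · obtain ⟨z, hz⟩ := hs.int x hx
    exact ⟨-z, by simp [hz]⟩
  · obtain ⟨x, hx, h1⟩ := hs.prim
    refine ⟨0 - x, sub_mem_latticePoints ⟨0, by ext; simp⟩ hx, by simp [h1]⟩
  · rcases hs.vert x hx with e | e
    · right; simp [e]
    · left; simp [e]

theorem affine_add_smul (h : (Fin n → ℝ) →ᵃ[ℝ] ℝ) (v d : Fin n → ℝ) (s : ℝ) :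
    h (v + s • d) = h v + s * h.linear d := by
  have := h.map_vadd v (s • d)
  simp only [vadd_eq_add, map_smul, smul_eq_mul] at this
  rw [add_comm v, this, add_comm]

theorem linear_eq_sum (h : (Fin n → ℝ) →ᵃ[ℝ] ℝ) (b : Module.Basis (Fin n) ℝ (Fin n → ℝ))
    (x : Fin n → ℝ) : h.linear x = ∑ i, b.repr x i * h.linear (b i) := by
  conv_lhs => rw [← b.sum_repr x, map_sum]
  simp

theorem affine_eq_sum (h : (Fin n → ℝ) →ᵃ[ℝ] ℝ) (b : Module.Basis (Fin n) ℝ (Fin n → ℝ))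
    (v x : Fin n → ℝ) : h x = h v + ∑ i, b.repr (x - v) i * h.linear (b i) := by
  rw [← linear_eq_sum, ← one_mul (h.linear _), ← affine_add_smul, one_smul, add_sub_cancel]

theorem IsSlab.exists_slanted (hs : IsSlab P h k) (b : Module.Basis (Fin n) ℝ (Fin n → ℝ)) :
    ∃ i, h.linear (b i) ≠ 0 := by
  by_contra! hcon
  obtain ⟨x, -, hx⟩ := hs.prim
  rw [linear_eq_sum h b] at hx
  simp [hcon] at hx

theorem IsSlab.mul_linear (hs : IsSlab P h k) (hc : IsVertexChart P v b t) (hv0 : h v = 0)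
    {i : Fin n} (hi : h.linear (b i) ≠ 0) : t i * h.linear (b i) = k := by
  have h1 := hs.vert _ (hc.nbr i)
  rw [affine_add_smul, hv0, zero_add] at h1
  exact h1.resolve_left (mul_ne_zero (hc.pos i).ne' hi)

theorem IsSlab.linear_nonneg (hs : IsSlab P h k) (hc : IsVertexChart P v b t) (hv0 : h v = 0)
    (i : Fin n) : 0 ≤ h.linear (b i) := by
  by_cases hi : h.linear (b i) = 0
  · rw [hi]
  have h1 := hs.mul_linear hc hv0 hi
  exact nonneg_of_mul_nonneg_right (h1 ▸ Nat.cast_nonneg k) (hc.pos i)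

theorem IsSlab.end_height (hs : IsSlab P h k) (hc : IsVertexChart P v b t) (hv0 : h v = 0)
    {i : Fin n} (hi : h.linear (b i) ≠ 0) : h (v + t i • b i) = k := by
  rw [affine_add_smul, hv0, zero_add, hs.mul_linear hc hv0 hi]

/-- If all slanted edges have heights divisible by `p`, then `p` is a unit. -/
theorem IsSlab.isUnit_of_dvd (hs : IsSlab P h k) (hc : IsVertexChart P v b t) (p : ℤ)
    (hp : ∀ i, ∃ z : ℤ, h.linear (b i) = z * p) : IsUnit p := by
  obtain ⟨x, hx, h1⟩ := hs.prim
  choose z hz using hp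
  choose y hy using (hc.lattice x).1 hx
  rw [linear_eq_sum h b] at h1
  simp only [hz, hy, ← mul_assoc, ← Finset.sum_mul] at h1
  exact IsUnit.of_mul_eq_one_right (∑ i, y i * z i) (by exact_mod_cast h1)

/-- All edges at `v` have one length, so all slanted directions have one height `p`. Primitivity
forces `p = 1`, whence the common length is `k`. -/
theorem IsSlab.strictCayley_of_simplex (hs : IsSlab P h k) (hv : v ∈ P.extremePoints ℝ)
    (hc : IsVertexChart P v b t) (hv0 : h v = 0)
    (hsimp : ∀ x ∈ P.extremePoints ℝ, x = v ∨ ∃ i, x = v + t i • b i) :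
    IsStrictCayleyPolytope P k := by
  have ht : ∀ i j, t i = t j := fun i j =>
    le_antisymm (hc.length_le_of_simplex hs.smooth hsimp j i)
      (hc.length_le_of_simplex hs.smooth hsimp i j)
  obtain ⟨i₀, hi₀⟩ := hs.exists_slanted b
  obtain ⟨p, hp⟩ := hs.int _ (hc.basis_mem i₀)
  have hunit : IsUnit p := by
    refine hs.isUnit_of_dvd hc p fun i => ?_
    by_cases hi : h.linear (b i) = 0
    · exact ⟨0, by simp [hi]⟩
    · refine ⟨1, ?_⟩
      have h1 := hs.mul_linear hc hv0 hi
      have h2 := hs.mul_linear hc hv0 hi₀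
      rw [ht i i₀] at h1
      rw [← hp, Int.cast_one, one_mul]
      exact mul_left_cancel₀ (hc.pos i₀).ne' (h1.trans h2.symm)
  have hp1 : p = 1 := by
    have h1 := hs.linear_nonneg hc hv0 i₀
    rw [hp] at h1
    have h2 : 0 ≤ p := by exact_mod_cast h1
    have h3 := Int.isUnit_iff.1 hunit
    omega
  have htk : ∀ i, t i = k := by
    intro i
    have h2 := hs.mul_linear hc hv0 hi₀
    rw [hp, hp1, Int.cast_one, mul_one] at h2
    rw [ht i i₀, h2]
  -- All coordinates become Cayley coordinates: `m = 0` and `r = n`, so the fibres are points of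
  -- `ℝ^0` and share their fan trivially.
  let e := (Equiv.emptySum (Fin 0) (Fin n)).symm
  have hrepr : ∀ x (j : Fin n), (b.reindex e).repr x (Sum.inr j) = b.repr x j := by
    intro x j
    simp [e]
  have hv_c : ∀ j : Fin n, (b.reindex e).repr (v - v) (Sum.inr j) =
      k * cayleyVertex (0 : Fin (n + 1)) j := by
    intro j
    simp [cayleyVertex_zero]
  have hw_c : ∀ i j : Fin n, (b.reindex e).repr (v + t i • b i - v) (Sum.inr j) =
      k * cayleyVertex i.succ j := by
    intro i j
    rw [hrepr, cayleyVertex_succ, htk]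
    simp [Finsupp.single_apply, Pi.single_apply, eq_comm]
  have hne : ∀ i : Fin (n + 1), ∃ x ∈ P.extremePoints ℝ,
      ∀ j, (b.reindex e).repr (x - v) (Sum.inr j) = k * cayleyVertex i j := by
    intro i
    refine Fin.cases ⟨v, hv, hv_c⟩ (fun i => ⟨_, hc.nbr i, hw_c i⟩) i
  refine isStrictCayleyPolytope_of_coordinates (b := b.reindex e) (v := v) hs.smooth i₀.pos ?_
    (hs.smooth.1.extremePoints_subset hv) ?_ hne ?_
  · intro x
    rw [hc.lattice]
    constructor
    · rintro hx (j | j)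
      · exact j.elim0
      · rw [hrepr]; exact hx j
    · intro hx j
      rw [← hrepr]; exact hx _
  · intro x hx
    rcases hsimp x hx with rfl | ⟨i, rfl⟩
    · exact ⟨0, hv_c⟩
    · exact ⟨i.succ, hw_c i⟩
  · have huniv : ∀ i, convexHull ℝ (cayleyFiber P (b.reindex e) v k i) = Set.univ := by
      intro i
      obtain ⟨x, hx, hxi⟩ := hne i
      have h1 : (convexHull ℝ (cayleyFiber P (b.reindex e) v k i)).Nonempty :=
        Set.Nonempty.convexHull ⟨_, x, ⟨hx, hxi⟩, rfl⟩
      exact Subsingleton.eq_univ_of_nonempty h1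
    intro i j
    rw [huniv, huniv]

/-- If all edges at a vertex are slanted, then its neighbours are the only other vertices. -/
theorem IsSlab.vertices_of_forall_slanted (hs : IsSlab P h k) (hc : IsVertexChart P v b t)
    (hv0 : h v = 0) (hall : ∀ i, h.linear (b i) ≠ 0) :
    ∀ x ∈ P.extremePoints ℝ, x = v ∨ ∃ i, x = v + t i • b i := by
  intro x hx
  have hk : (0 : ℝ) < k := by exact_mod_cast hs.pos
  have hsum := affine_eq_sum h b v x
  rw [hv0, zero_add] at hsum
  rcases hs.vert x hx with h0 | h1
  · left
    rw [h0, eq_comm, Finset.sum_eq_zero_iff_of_nonneg fun i _ =>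
      mul_nonneg (hc.cone x hx.1 i) (hs.linear_nonneg hc hv0 i)] at hsum
    have : b.repr (x - v) = 0 := by
      ext i
      exact (mul_eq_zero.1 (hsum i (Finset.mem_univ i))).resolve_right (hall i)
    rw [← sub_eq_zero]
    exact b.repr.map_eq_zero_iff.1 this
  · right
    set w : Fin n → (Fin n → ℝ) := fun i => v + t i • b i with hw
    -- Height `k` means that the coordinates of `x`, rescaled by edge lengths, sum to `1`: `x` is a
    -- convex combination of the neighbours and, being extreme, equals one of them.
    have hlam : ∀ i, b.repr (x - v) i / t i = b.repr (x - v) i * h.linear (b i) / k := by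
      intro i
      have h2 := hs.mul_linear hc hv0 (hall i)
      rw [div_eq_div_iff (hc.pos i).ne' hk.ne', ← h2]
      ring
    have hsum1 : ∑ i, b.repr (x - v) i / t i = 1 := by
      simp only [hlam]
      rw [← Finset.sum_div, ← hsum, h1, div_self hk.ne']
    have hxw : x = ∑ i, (b.repr (x - v) i / t i) • w i := by
      simp only [hw, smul_add, Finset.sum_add_distrib, ← Finset.sum_smul, hsum1, one_smul]
      have : ∀ i, (b.repr (x - v) i / t i) • t i • b i = b.repr (x - v) i • b i := fun i => by
        rw [smul_smul, div_mul_cancel₀ _ (hc.pos i).ne']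
      simp only [this, b.sum_repr, add_sub_cancel]
    have hmem : x ∈ convexHull ℝ (Set.range w) := by
      rw [hxw]
      exact (convex_convexHull ℝ _).sum_mem
        (fun i _ => div_nonneg (hc.cone x hx.1 i) (hc.pos i).le) hsum1
        (fun i _ => subset_convexHull ℝ _ ⟨i, rfl⟩)
    have hsub : convexHull ℝ (Set.range w) ⊆ P := by
      refine convexHull_min ?_ hs.smooth.1.convex
      rintro _ ⟨i, rfl⟩
      exact (hc.nbr i).1
    obtain ⟨i, hi⟩ := extremePoints_convexHull_subset
      (inter_extremePoints_subset_extremePoints_of_subset hsub ⟨hmem, hx⟩)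
    exact ⟨i, hi.symm⟩

theorem not_extreme_between {P : Set (Fin n → ℝ)} {v d : Fin n → ℝ} (hd : d ≠ 0) {a c : ℝ}
    (ha : 0 < a) (hac : a < c) (hv : v ∈ P) (hvc : v + c • d ∈ P) :
    v + a • d ∉ P.extremePoints ℝ := by
  intro hmem
  have hc : 0 < c := ha.trans hac
  have h1 : v = v + a • d := by
    refine hmem.2 hv hvc ⟨1 - a / c, a / c, ?_, div_pos ha hc, by ring, ?_⟩
    · rw [sub_pos, div_lt_one hc]; exact hac
    · rw [smul_add, smul_smul, div_mul_cancel₀ _ hc.ne', ← add_assoc, ← add_smul, sub_add_cancel,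
        one_smul]
  have h2 : a • d = 0 := left_eq_add.1 h1
  exact (smul_ne_zero ha.ne' hd) h2

/-- If exactly one edge at a vertex is horizontal, then its ends are the only vertices at this
height. -/
theorem IsSlab.vertices_of_one_horizontal (hs : IsSlab P h k) (hv : v ∈ P.extremePoints ℝ)
    (hc : IsVertexChart P v b t) (hv0 : h v = 0) {i₃ : Fin n}
    (hsl : ∀ i, i ≠ i₃ → h.linear (b i) ≠ 0) {x : Fin n → ℝ} (hx : x ∈ P.extremePoints ℝ)
    (hx0 : h x = 0) : x = v ∨ x = v + t i₃ • b i₃ := by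
  have hsum := affine_eq_sum h b v x
  rw [hv0, zero_add, hx0, eq_comm, Finset.sum_eq_zero_iff_of_nonneg fun i _ =>
    mul_nonneg (hc.cone x hx.1 i) (hs.linear_nonneg hc hv0 i)] at hsum
  have hz : ∀ i, i ≠ i₃ → b.repr (x - v) i = 0 := fun i hi =>
    (mul_eq_zero.1 (hsum i (Finset.mem_univ i))).resolve_right (hsl i hi)
  have hxv : x = v + b.repr (x - v) i₃ • b i₃ := by
    rw [← sub_eq_iff_eq_add']
    conv_lhs => rw [← b.sum_repr (x - v)]
    exact Finset.sum_eq_single i₃ (fun i _ hi => by rw [hz i hi, zero_smul]) (by simp)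
  have hc0 := hc.cone x hx.1 i₃
  set c := b.repr (x - v) i₃
  rcases hc0.eq_or_lt with h0 | h0
  · left; rw [hxv, ← h0, zero_smul, add_zero]
  -- Three collinear points of `P`: unless `c = t i₃`, one of the vertices `x` and `v + t i₃ • b i₃`
  -- lies strictly between two points of `P`.
  rcases lt_trichotomy c (t i₃) with h1 | h1 | h1
  · exact absurd (hxv ▸ hx) (not_extreme_between (b.ne_zero i₃) h0 h1 hv.1 (hc.nbr i₃).1)
  · right; rw [hxv, h1]
  · exact absurd (hc.nbr i₃) (not_extreme_between (b.ne_zero i₃) (hc.pos i₃) h1 hv.1 (hxv ▸ hx.1))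

end Slab

theorem exists_eq_one_of_sum_eq_one {ι : Type*} [Fintype ι] {p : ι → Prop} {y : ι → ℝ}
    (hint : ∀ i, ∃ z : ℤ, y i = z) (hnn : ∀ i, 0 ≤ y i) {c : ι → ℝ} (hc0 : ∀ i, ¬ p i → c i = 0)
    (hc1 : ∀ i, p i → c i = 1) (hsum : ∑ i, y i * c i = 1) :
    ∃ i, p i ∧ y i = 1 ∧ ∀ j, p j → j ≠ i → y j = 0 := by
  obtain ⟨i, -, hi⟩ := Finset.exists_ne_zero_of_sum_ne_zero (hsum.trans_ne one_ne_zero)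
  have hpi : p i := by
    by_contra h
    exact hi (by rw [hc0 i h, mul_zero])
  have hyi : 1 ≤ y i := by
    obtain ⟨z, hz⟩ := hint i
    have h1 : 0 < y i := lt_of_le_of_ne (hnn i) (Ne.symm (left_ne_zero_of_mul hi))
    rw [hz] at h1 ⊢
    have : 0 < z := by exact_mod_cast h1
    exact_mod_cast this
  have hterm : ∀ j ∈ Finset.univ, 0 ≤ y j * c j := by
    intro j _
    by_cases hj : p j
    · rw [hc1 j hj, mul_one]; exact hnn j
    · rw [hc0 j hj, mul_zero]
  refine ⟨i, hpi, le_antisymm ?_ hyi, fun j hj hji => le_antisymm ?_ (hnn j)⟩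
  · have := Finset.single_le_sum hterm (Finset.mem_univ i)
    rwa [hsum, hc1 i hpi, mul_one] at this
  · have := Finset.add_le_sum hterm (Finset.mem_univ j) (Finset.mem_univ i) hji
    rw [hsum, hc1 i hpi, hc1 j hj] at this
    linarith

/-! ### Slabs with a vertex not of prism type. -/

section Wedge

variable {n k : ℕ} {P : Set (Fin n → ℝ)} {h : (Fin n → ℝ) →ᵃ[ℝ] ℝ} {v : Fin n → ℝ}
  {b : Module.Basis (Fin n) ℝ (Fin n → ℝ)} {t : Fin n → ℝ}

/-- The height of the only slanted direction divides the height of every lattice vector, and one of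
these heights is `1`. -/
theorem IsSlab.linear_eq_one_or_neg_one (hs : IsSlab P h k) (hc : IsVertexChart P v b t)
    {i : Fin n} (hi : ∀ l, l ≠ i → h.linear (b l) = 0) :
    h.linear (b i) = 1 ∨ h.linear (b i) = -1 := by
  obtain ⟨p, hp⟩ := hs.int _ (hc.basis_mem i)
  have hunit : IsUnit p := by
    refine hs.isUnit_of_dvd hc p fun l => ?_
    by_cases hl : l = i
    · exact ⟨1, by simp [hl, hp]⟩
    · exact ⟨0, by simp [hi l hl]⟩
  rcases Int.isUnit_iff.1 hunit with rfl | rfl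
  · left; simp [hp]
  · right; simp [hp]

/-- The top vertices of a slab at which just one edge is slanted lie over bottom vertices. -/
theorem IsSlab.exists_below (hs : IsSlab P h k) {w : Fin n → ℝ}
    {c : Module.Basis (Fin n) ℝ (Fin n → ℝ)} {s : Fin n → ℝ}
    (hc : IsVertexChart P w c s) (hw : h w = k) (hpr : IsPrismAt h c) :
    ∃ e ∈ P.extremePoints ℝ, h e = 0 ∧ ∃ d ∈ edgeVectors P e, h.linear d = 1 ∧
      w = e + (k : ℝ) • d := by
  obtain ⟨i, hi, hl⟩ := hpr
  have hk : (0 : ℝ) < k := by exact_mod_cast hs.pos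
  have h1 := affine_add_smul h w (c i) (s i)
  have hsi := hc.pos i
  have hend : h (w + s i • c i) = 0 := by
    refine (hs.vert _ (hc.nbr i)).resolve_right fun h2 => ?_
    rw [h2, hw] at h1
    exact (mul_ne_zero hsi.ne' hi) (by linarith)
  rw [hend, hw] at h1
  have hci : h.linear (c i) = -1 := by
    refine (hs.linear_eq_one_or_neg_one hc hl).resolve_left fun h2 => ?_
    rw [h2] at h1
    linarith
  have hsk : s i = k := by
    rw [hci] at h1
    linarith
  refine ⟨_, hc.nbr i, hend, _, hc.rev i, by rw [map_neg, hci, neg_neg], ?_⟩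
  rw [hsk, smul_neg, add_neg_cancel_right]

/-- The bottom is an edge in direction `b i₃`. Every top vertex lies over it along a lattice
direction of height `1`, whose coordinates other than the `i₃`-th are nonnegative integers with sum
`1`. So, up to the `i₃`-th coordinate, each vertex is the origin or `k` times a basis vector, and
the fibres are segments parallel to `b i₃`. -/
theorem IsSlab.strictCayley_of_wedge (hs : IsSlab P h k) (hv : v ∈ P.extremePoints ℝ)
    (hc : IsVertexChart P v b t) (hv0 : h v = 0) {i₃ : Fin n} (hi₃ : h.linear (b i₃) = 0)
    (hsl : ∀ i, i ≠ i₃ → h.linear (b i) ≠ 0)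
    (htop : ∀ w ∈ P.extremePoints ℝ, h w = k → ∀ c s, IsVertexChart P w c s → IsPrismAt h c)
    {r : ℕ} (e : Fin n ≃ Fin 1 ⊕ Fin r) (he : e i₃ = Sum.inl 0) :
    IsStrictCayleyPolytope P k := by
  have hk : (0 : ℝ) < k := by exact_mod_cast hs.pos
  set v₃ := v + t i₃ • b i₃ with hv₃
  -- At the upper end of a slanted edge the reversed edge is the only slanted one, so its height is
  -- `±1`; from the bottom, edges only go up.
  have hlin : ∀ i, i ≠ i₃ → h.linear (b i) = 1 := by
    intro i hi
    have hwk := hs.end_height hc hv0 (hsl i hi)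
    obtain ⟨c, s, hc'⟩ := hs.smooth.exists_vertexChart (hc.nbr i)
    obtain ⟨i₀, hi₀, hl⟩ := htop _ (hc.nbr i) hwk c s hc'
    obtain ⟨l, hl'⟩ := hc'.edges _ (hc.rev i)
    have hli : l = i₀ := by
      by_contra hne
      have h1 := hl l hne
      rw [hl', map_neg, neg_eq_zero] at h1
      exact hsl i hi h1
    have hnn := hs.linear_nonneg hc hv0 i
    have h1 := hs.linear_eq_one_or_neg_one hc' hl
    rw [← hli, hl', map_neg] at h1
    rcases h1 with h1 | h1 <;> linarith
  have htk : ∀ i, i ≠ i₃ → t i = k := by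
    intro i hi
    have := hs.mul_linear hc hv0 (hsl i hi)
    rwa [hlin i hi, mul_one] at this
  have hbot : ∀ x ∈ P.extremePoints ℝ, h x = 0 → ∀ i, i ≠ i₃ → b.repr (x - v) i = 0 := by
    intro x hx hx0 i hi
    rcases hs.vertices_of_one_horizontal hv hc hv0 hsl hx hx0 with rfl | rfl
    · simp
    · simp [Ne.symm hi]
  have htopc : ∀ x ∈ P.extremePoints ℝ, h x = k → ∃ i, i ≠ i₃ ∧ b.repr (x - v) i = k ∧
      ∀ j, j ≠ i₃ → j ≠ i → b.repr (x - v) j = 0 := by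
    intro x hx hxk
    obtain ⟨c, s, hc'⟩ := hs.smooth.exists_vertexChart hx
    obtain ⟨e, he, he0, d, hd, hd1, hxe⟩ := hs.exists_below hc' hxk (htop x hx hxk c s hc')
    have hcoord : ∀ i, i ≠ i₃ → b.repr (x - v) i = k * b.repr d i := by
      intro i hi
      have : x - v = (e - v) + (k : ℝ) • d := by rw [hxe]; abel
      rw [this, map_add, map_smul, Finsupp.add_apply, hbot e he he0 i hi, zero_add]
      rfl
    have hdl : d ∈ latticePoints (Fin n) := by
      obtain ⟨z, -, rfl⟩ := hd
      exact ⟨z, rfl⟩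
    have hdint := (hc.lattice d).1 hdl
    obtain ⟨i, hi, hi1, hj⟩ := exists_eq_one_of_sum_eq_one (p := fun i => i ≠ i₃)
      (y := fun i => if i = i₃ then 0 else b.repr d i) (c := fun i => h.linear (b i))
      (fun i => by
        by_cases hi : i = i₃
        · exact ⟨0, by simp [hi]⟩
        · obtain ⟨z, hz⟩ := hdint i
          exact ⟨z, by simp [hi, hz]⟩)
      (fun i => by
        by_cases hi : i = i₃
        · simp [hi]
        · simp only [hi, if_false]
          have h1 := hc.cone x hx.1 i
          rw [hcoord i hi] at h1
          exact nonneg_of_mul_nonneg_right h1 hk)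
      (fun i hi => by rw [not_not.1 hi, hi₃]) hlin
      (by
        rw [← hd1, linear_eq_sum h b d]
        refine Finset.sum_congr rfl fun i _ => ?_
        by_cases hi : i = i₃
        · simp [hi, hi₃]
        · simp [hi])
    refine ⟨i, hi, ?_, fun j hj3 hji => ?_⟩
    · simp only [hi, if_false] at hi1
      rw [hcoord i hi, hi1, mul_one]
    · have := hj j hj3 hji
      simp only [hj3, if_false] at this
      rw [hcoord j hj3, this, mul_zero]
  have hesymm : ∀ j, e.symm (Sum.inr j) ≠ i₃ := by
    intro j hj
    have := congrArg e hj
    rw [Equiv.apply_symm_apply, he] at this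
    cases this
  have hei : ∀ i, i ≠ i₃ → ∃ j, i = e.symm (Sum.inr j) := by
    intro i hi
    rcases h1 : e i with j | j
    · exfalso
      rw [Fin.fin_one_eq_zero j, ← he] at h1
      exact hi (e.injective h1)
    · exact ⟨j, by rw [← h1, Equiv.symm_apply_apply]⟩
  have hinl : ∀ x (j : Fin 1), (b.reindex e).repr x (Sum.inl j) = b.repr x i₃ := by
    intro x j
    rw [Fin.fin_one_eq_zero j, ← he]
    simp
  have hinr : ∀ x (j : Fin r), (b.reindex e).repr x (Sum.inr j) = b.repr x (e.symm (Sum.inr j)) := by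
    intro x j
    simp
  have hzero : ∀ x, (∀ i, i ≠ i₃ → b.repr (x - v) i = 0) → ∀ j : Fin r,
      (b.reindex e).repr (x - v) (Sum.inr j) = k * cayleyVertex (0 : Fin (r + 1)) j := by
    intro x hx j
    rw [hinr, hx _ (hesymm j), cayleyVertex_zero]
    simp
  have hsucc : ∀ x (l : Fin r), b.repr (x - v) (e.symm (Sum.inr l)) = k →
      (∀ j, j ≠ i₃ → j ≠ e.symm (Sum.inr l) → b.repr (x - v) j = 0) → ∀ j : Fin r,
      (b.reindex e).repr (x - v) (Sum.inr j) = k * cayleyVertex l.succ j := by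
    intro x l hx hx' j
    rw [hinr, cayleyVertex_succ]
    by_cases hj : j = l
    · rw [hj, hx]; simp
    · rw [hx' _ (hesymm j) (fun h => hj (Sum.inr_injective (e.symm.injective h)))]
      simp [hj]
  have hends : ∀ i, i ≠ i₃ → ∀ j, b.repr (v + t i • b i - v) j = if j = i then (k : ℝ) else 0 := by
    intro i hi j
    rw [add_sub_cancel_left, map_smul, b.repr_self, htk i hi]
    simp [Finsupp.single_apply, eq_comm]
  -- Two vertices with different `i₃`-coordinates in each fibre keep the segments from degenerating
  -- to points.
  have htwo : ∀ i : Fin (r + 1), ∃ x ∈ P.extremePoints ℝ, ∃ y ∈ P.extremePoints ℝ,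
      (∀ j, (b.reindex e).repr (x - v) (Sum.inr j) = k * cayleyVertex i j) ∧
      (∀ j, (b.reindex e).repr (y - v) (Sum.inr j) = k * cayleyVertex i j) ∧
      b.repr (x - v) i₃ ≠ b.repr (y - v) i₃ := by
    intro i
    refine Fin.cases ?_ (fun l => ?_) i
    · refine ⟨v, hv, v₃, hc.nbr i₃, hzero v (by simp), hzero v₃ ?_, ?_⟩
      · intro i hi
        simp [hv₃, Ne.symm hi]
      · simp [hv₃, (hc.pos i₃).ne]
    · set i := e.symm (Sum.inr l) with hi
      have hi3 : i ≠ i₃ := hesymm l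
      set w := v + t i • b i with hw
      have hwk : h w = k := hs.end_height hc hv0 (hsl i hi3)
      obtain ⟨c, s, hc'⟩ := hs.smooth.exists_vertexChart (hc.nbr i)
      obtain ⟨i₀, hi₀, hl⟩ := htop _ (hc.nbr i) hwk c s hc'
      obtain ⟨l₀, hl₀⟩ := hc'.edges _ (hc.rev i)
      have hcoordw := hends i hi3
      have hli : l₀ = i₀ := by
        by_contra hne
        have h1 := hl l₀ hne
        rw [hl₀, map_neg, neg_eq_zero] at h1
        exact hsl i hi3 h1
      -- The second vertex over `w` is a neighbour of `w`. Since `v₃` lies in the cone at `w` and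
      -- differs from `w` in the `i₃`-th coordinate, some edge `c m` with positive weight moves that
      -- coordinate.
      have hexp : ∀ j, b.repr (v₃ - w) j = ∑ m, c.repr (v₃ - w) m * b.repr (c m) j := by
        intro j
        have h := congrArg (fun x => b.coord j x) (c.sum_repr (v₃ - w))
        simp only [map_sum, map_smul, smul_eq_mul, Module.Basis.coord_apply] at h
        exact h.symm
      have hcone : ∀ m, 0 ≤ c.repr (v₃ - w) m := hc'.cone v₃ (hc.nbr i₃).1
      have h3 : b.repr (v₃ - w) i₃ ≠ 0 := by
        have : v₃ - w = t i₃ • b i₃ - t i • b i := by rw [hv₃, hw]; abel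
        rw [this]
        simp [hi3, (hc.pos i₃).ne']
      rw [hexp] at h3
      obtain ⟨m, -, hm⟩ := Finset.exists_ne_zero_of_sum_ne_zero h3
      have hmpos : 0 < c.repr (v₃ - w) m :=
        lt_of_le_of_ne (hcone m) (Ne.symm (left_ne_zero_of_mul hm))
      have hm3 : b.repr (c m) i₃ ≠ 0 := right_ne_zero_of_mul hm
      have hmi : m ≠ i₀ := by
        rintro rfl
        rw [← hli, hl₀] at hm3
        simp [hi3] at hm3
      have hsplit : ∀ j, b.repr (w + s m • c m - v) j = b.repr (w - v) j + s m * b.repr (c m) j := by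
        intro j
        rw [add_sub_right_comm, map_add, map_smul]
        rfl
      -- For these `j`, `w` has minimal `j`-th coordinate on `P`, so no edge at `w` decreases it; as
      -- `v₃` has the same value, edges of positive weight preserve it.
      have hj0 : ∀ j, j ≠ i₃ → j ≠ i → b.repr (c m) j = 0 := by
        intro j hj3 hji
        have hnn : ∀ m, 0 ≤ b.repr (c m) j := by
          intro m
          have h1 := hc.cone _ (hc'.nbr m).1 j
          have h2 : b.repr (w + s m • c m - v) j = b.repr (w - v) j + s m * b.repr (c m) j := by
            rw [add_sub_right_comm, map_add, map_smul]
            rfl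
          rw [h2, hcoordw j, if_neg hji, zero_add] at h1
          exact nonneg_of_mul_nonneg_right h1 (hc'.pos m)
        have h1 := hexp j
        have h2 : b.repr (v₃ - w) j = 0 := by
          have : v₃ - w = t i₃ • b i₃ - t i • b i := by rw [hv₃, hw]; abel
          rw [this]
          simp [Ne.symm hj3, Ne.symm hji]
        rw [h2, eq_comm, Finset.sum_eq_zero_iff_of_nonneg fun m _ =>
          mul_nonneg (hcone m) (hnn m)] at h1
        exact (mul_eq_zero.1 (h1 m (Finset.mem_univ m))).resolve_left hmpos.ne'
      -- The edge is horizontal and its other coordinates contributing to the height vanish, so the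
      -- `i`-th does too.
      have hi0 : b.repr (c m) i = 0 := by
        have h1 := hl m hmi
        rw [linear_eq_sum h b, Finset.sum_eq_single i, hlin i hi3, mul_one] at h1
        · exact h1
        · intro j _ hji
          by_cases hj3 : j = i₃
          · rw [hj3, hi₃, mul_zero]
          · rw [hj0 j hj3 hji, zero_mul]
        · simp
      refine ⟨w, hc.nbr i, w + s m • c m, hc'.nbr m, hsucc w l ?_ ?_, hsucc _ l ?_ ?_, ?_⟩
      · rw [hcoordw, if_pos rfl]
      · intro j _ hji
        rw [hcoordw, if_neg hji]
      · rw [hsplit, hcoordw, if_pos rfl, hi0, mul_zero, add_zero]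
      · intro j hj3 hji
        rw [hsplit, hcoordw, if_neg hji, hj0 j hj3 hji, mul_zero, add_zero]
      · rw [hsplit]
        intro h1
        exact (mul_ne_zero (hc'.pos m).ne' hm3) (left_eq_add.1 h1)
  have hr : 0 < r := by
    obtain ⟨i, hi⟩ := hs.exists_slanted b
    obtain ⟨j, -⟩ := hei i (fun h1 => hi (h1 ▸ hi₃))
    exact j.pos
  have hb : ∀ x, x ∈ latticePoints (Fin n) ↔ ∀ i, ∃ z : ℤ, (b.reindex e).repr x i = z := by
    intro x
    rw [hc.lattice]
    constructor
    · intro hx i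
      obtain ⟨z, hz⟩ := hx (e.symm i)
      exact ⟨z, by simpa using hz⟩
    · intro hx i
      obtain ⟨z, hz⟩ := hx (e i)
      exact ⟨z, by simpa using hz⟩
  have hvl := hs.smooth.1.extremePoints_subset hv
  have hne : ∀ i : Fin (r + 1), ∃ x ∈ P.extremePoints ℝ,
      ∀ j, (b.reindex e).repr (x - v) (Sum.inr j) = k * cayleyVertex i j := by
    intro i
    obtain ⟨x, hx, -, -, hxi, -⟩ := htwo i
    exact ⟨x, hx, hxi⟩
  refine isStrictCayleyPolytope_of_coordinates (b := b.reindex e) (v := v) hs.smooth hr hb hvl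
    ?_ hne ?_
  · intro x hx
    rcases hs.vert x hx with hx0 | hxk
    · exact ⟨0, hzero x (hbot x hx hx0)⟩
    · obtain ⟨i, hi, hik, hj⟩ := htopc x hx hxk
      obtain ⟨l, rfl⟩ := hei i hi
      exact ⟨l.succ, hsucc x l hik hj⟩
  · have hnt : ∀ i, (convexHull ℝ (cayleyFiber P (b.reindex e) v k i)).Nontrivial := by
      intro i
      obtain ⟨x, hx, y, hy, hxi, hyi, hxy⟩ := htwo i
      refine ⟨_, subset_convexHull ℝ _ ⟨x, ⟨hx, hxi⟩, rfl⟩,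
        _, subset_convexHull ℝ _ ⟨y, ⟨hy, hyi⟩, rfl⟩, fun h1 => hxy ?_⟩
      have := congrFun h1 0
      simpa only [hinl] using this
    intro i j
    exact normalFan_segment_eq (isLatticePolytope_cayleyFiber hs.smooth.1 hb hvl i (hne i))
      (isLatticePolytope_cayleyFiber hs.smooth.1 hb hvl j (hne j)) (hnt i) (hnt j)

/-- In dimension at most three, a chart that is not of prism type has at most one horizontal
edge. -/
theorem IsSlab.chart_cases (hs : IsSlab P h k) (hn : n ≤ 3)
    (b : Module.Basis (Fin n) ℝ (Fin n → ℝ)) (hpr : ¬ IsPrismAt h b) :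
    (∀ i, h.linear (b i) ≠ 0) ∨ n = 3 ∧ ∃ i₃, h.linear (b i₃) = 0 ∧
      (∀ i, i ≠ i₃ → h.linear (b i) ≠ 0) ∧
      ∃ i j, i ≠ j ∧ h.linear (b i) ≠ 0 ∧ h.linear (b j) ≠ 0 := by
  by_cases hall : ∀ i, h.linear (b i) ≠ 0
  · exact Or.inl hall
  right
  push Not at hall
  obtain ⟨i₃, hi₃⟩ := hall
  obtain ⟨i, hi⟩ := hs.exists_slanted b
  have hj : ∃ j, j ≠ i ∧ h.linear (b j) ≠ 0 := by
    by_contra! hcon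
    exact hpr ⟨i, hi, hcon⟩
  obtain ⟨j, hji, hj⟩ := hj
  have h1 : i ≠ i₃ := fun e => hi (e ▸ hi₃)
  have h2 : j ≠ i₃ := fun e => hj (e ▸ hi₃)
  refine ⟨by omega, i₃, hi₃, fun l hl => ?_, i, j, Ne.symm hji, hi, hj⟩
  have : l = i ∨ l = j := by omega
  rcases this with rfl | rfl
  · exact hi
  · exact hj

/-- The remaining case has a vertex not of prism type at both heights. Unless one of them has only
slanted edges, top and bottom are both edges, and the four vertices span a simplex. -/
theorem IsSlab.strictCayley_of_not_prism (hs : IsSlab P h k) (hn : n ≤ 3)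
    (hv : v ∈ P.extremePoints ℝ) (hc : IsVertexChart P v b t) (hv0 : h v = 0)
    (hpr : ¬ IsPrismAt h b) : IsStrictCayleyPolytope P k := by
  rcases hs.chart_cases hn b hpr with hall | ⟨hn3, i₃, hi₃, hsl, i, j, hij, hi, hj⟩
  · exact hs.strictCayley_of_simplex hv hc hv0 (hs.vertices_of_forall_slanted hc hv0 hall)
  by_cases htop : ∀ w ∈ P.extremePoints ℝ, h w = k → ∀ c s, IsVertexChart P w c s → IsPrismAt h c
  -- The swap makes the horizontal direction the fibre coordinate.
  · subst hn3
    refine hs.strictCayley_of_wedge hv hc hv0 hi₃ hsl htop (r := 2)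
      ((Equiv.swap 0 i₃).trans (finSumFinEquiv (m := 1) (n := 2)).symm) ?_
    simp only [Equiv.trans_apply, Equiv.swap_apply_right]
    rfl
  push Not at htop
  obtain ⟨w, hw, hwk, c, s, hc', hprw⟩ := htop
  have hs' := hs.flip
  set h' := AffineMap.const ℝ (Fin n → ℝ) (k : ℝ) - h with hh'
  have hlin' : ∀ x, h'.linear x = - h.linear x := by
    intro x; simp [hh']
  have hval' : ∀ x, h' x = k - h x := by
    intro x; simp [hh']
  have hpr' : ¬ IsPrismAt h' c := by
    rintro ⟨i, hi, hl⟩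
    refine hprw ⟨i, fun e => hi (by rw [hlin', e, neg_zero]), fun l hli => ?_⟩
    have := hl l hli
    rwa [hlin', neg_eq_zero] at this
  have hw0 : h' w = 0 := by rw [hval', hwk, sub_self]
  rcases hs'.chart_cases hn c hpr' with hall | ⟨-, l₃, hl₃, hsl', -⟩
  · exact hs'.strictCayley_of_simplex hw hc' hw0 (hs'.vertices_of_forall_slanted hc' hw0 hall)
  have htopv : ∀ x ∈ P.extremePoints ℝ, h x = k → x = w ∨ x = w + s l₃ • c l₃ := fun x hx hxk =>
    hs'.vertices_of_one_horizontal hw hc' hw0 hsl' hx (by rw [hval', hxk, sub_self])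
  refine hs.strictCayley_of_simplex hv hc hv0 fun x hx => ?_
  rcases hs.vert x hx with hx0 | hxk
  · rcases hs.vertices_of_one_horizontal hv hc hv0 hsl hx hx0 with e | e
    · exact Or.inl e
    · exact Or.inr ⟨i₃, e⟩
  right
  -- The two slanted edges at `v` have distinct upper ends, which exhaust the at most two top
  -- vertices; so every top vertex is a neighbour of `v`.
  have hne : v + t i • b i ≠ v + t j • b j := by
    intro e
    have h1 := congrArg (fun x => b.repr x i) (add_left_cancel e)
    simp [Ne.symm hij, (hc.pos i).ne'] at h1
  have hi' := htopv _ (hc.nbr i) (hs.end_height hc hv0 hi)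
  have hj' := htopv _ (hc.nbr j) (hs.end_height hc hv0 hj)
  have hx' := htopv x hx hxk
  by_cases h1 : x = v + t i • b i
  · exact ⟨i, h1⟩
  · refine ⟨j, ?_⟩
    grind

/-- A smooth polytope of dimension at most three between two lattice hyperplanes is a strict Cayley
polytope unless at each vertex just one edge is slanted. -/
theorem IsSlab.prism_or_strictCayley (hs : IsSlab P h k) (hn : n ≤ 3) :
    (∀ v ∈ P.extremePoints ℝ, ∀ b t, IsVertexChart P v b t → IsPrismAt h b) ∨
      IsStrictCayleyPolytope P k := by
  by_contra! hcon
  obtain ⟨⟨v, hv, b, t, hc, hpr⟩, hcon⟩ := hcon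
  rcases hs.vert v hv with hv0 | hvk
  · exact hcon (hs.strictCayley_of_not_prism hn hv hc hv0 hpr)
  · refine hcon (hs.flip.strictCayley_of_not_prism hn hv hc (by simp [hvk]) ?_)
    rintro ⟨i, hi, hl⟩
    refine hpr ⟨i, fun e => hi (by simp [e]), fun l hli => ?_⟩
    simpa using hl l hli

end Wedge

/-! ### Slabs of prism type: pairing opposite vertices. -/

section Prism

variable {n k : ℕ} {P : Set (Fin n → ℝ)} {h : (Fin n → ℝ) →ᵃ[ℝ] ℝ} {v : Fin n → ℝ}
  {b : Module.Basis (Fin n) ℝ (Fin n → ℝ)} {t : Fin n → ℝ}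

/-- Minimality within a level is transported along the unique slanted edge. -/
theorem IsVertexChart.le_of_level_le (hc : IsVertexChart P v b t) {i : Fin n}
    (hi : h.linear (b i) ≠ 0) (hl : ∀ l, l ≠ i → h.linear (b l) = 0) (g : (Fin n → ℝ) →ᵃ[ℝ] ℝ)
    (hmin : ∀ y ∈ P, h y = h v → g v ≤ g y) :
    ∀ y ∈ P, h y = h (v + t i • b i) → g (v + t i • b i) ≤ g y := by
  intro y hy hyw
  -- With this `c`, `g + c * h` is constant along the slanted edge. It does not decrease along the
  -- horizontal edges, so over `P` it is minimal on the whole slanted edge; within a level, `h` is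
  -- constant and `g` alone is minimal.
  set c := -g.linear (b i) / h.linear (b i) with hcdef
  have hci : g.linear (b i) + c * h.linear (b i) = 0 := by
    rw [hcdef, div_mul_cancel₀ _ hi, add_neg_cancel]
  have hG : ∀ l, 0 ≤ g.linear (b l) + c * h.linear (b l) := by
    intro l
    by_cases hli : l = i
    · rw [hli, hci]
    rw [hl l hli, mul_zero, add_zero]
    have h1 := hmin _ (hc.nbr l).1 (by rw [affine_add_smul, hl l hli, mul_zero, add_zero])
    rw [affine_add_smul, le_add_iff_nonneg_right] at h1
    exact nonneg_of_mul_nonneg_right h1 (hc.pos l)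
  have hsum : 0 ≤ ∑ l, b.repr (y - v) l * (g.linear (b l) + c * h.linear (b l)) :=
    Finset.sum_nonneg fun l _ => mul_nonneg (hc.cone y hy l) (hG l)
  have hg := affine_eq_sum g b v y
  have hh := affine_eq_sum h b v y
  have e : ∑ l, b.repr (y - v) l * (g.linear (b l) + c * h.linear (b l)) =
      (g y - g v) + c * (h y - h v) := by
    rw [hg, hh, add_sub_cancel_left, add_sub_cancel_left, Finset.mul_sum, ← Finset.sum_add_distrib]
    exact Finset.sum_congr rfl fun l _ => by ring
  rw [e, hyw, affine_add_smul] at hsum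
  rw [affine_add_smul]
  have : c * (h v + t i * h.linear (b i) - h v) = - (t i * g.linear (b i)) := by
    have : c * h.linear (b i) = - g.linear (b i) := by linarith
    calc _ = t i * (c * h.linear (b i)) := by ring
      _ = _ := by rw [this]; ring
  linarith

/-- The unique slanted edge at the other end is the reversed one and leads back to `v`, so
minimality passes in both directions. -/
theorem IsSlab.exists_opposite (hs : IsSlab P h k) (hv : v ∈ P.extremePoints ℝ)
    (hpr : ∀ v ∈ P.extremePoints ℝ, ∀ b t, IsVertexChart P v b t → IsPrismAt h b) :
    ∃ w ∈ P.extremePoints ℝ, h w ≠ h v ∧ ∀ g : (Fin n → ℝ) →ᵃ[ℝ] ℝ,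
      (∀ y ∈ P, h y = h v → g v ≤ g y) ↔ (∀ y ∈ P, h y = h w → g w ≤ g y) := by
  obtain ⟨b, t, hc⟩ := hs.smooth.exists_vertexChart hv
  obtain ⟨i, hi, hl⟩ := hpr v hv b t hc
  obtain ⟨c, s, hc'⟩ := hs.smooth.exists_vertexChart (hc.nbr i)
  obtain ⟨j, hj, hl'⟩ := hpr _ (hc.nbr i) c s hc'
  obtain ⟨l, hlc⟩ := hc'.edges _ (hc.rev i)
  have hlj : l = j := by
    by_contra hne
    have h1 := hl' l hne
    rw [hlc, map_neg, neg_eq_zero] at h1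
    exact hi h1
  subst hlj
  have hwv : h (v + t i • b i) ≠ h v := by
    rw [affine_add_smul]
    intro e
    exact (mul_ne_zero (hc.pos i).ne' hi) (by linarith)
  have hx := affine_add_smul h (v + t i • b i) (c l) (s l)
  have hxw : h (v + t i • b i + s l • c l) ≠ h (v + t i • b i) := by
    rw [hx]
    intro e
    exact (mul_ne_zero (hc'.pos l).ne' hj) (by linarith)
  -- With only two heights available, changing height twice restores the first.
  have hxv : h (v + t i • b i + s l • c l) = h v := by
    rcases hs.vert _ hv with h1 | h1 <;> rcases hs.vert _ (hc.nbr i) with h2 | h2 <;>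
      rcases hs.vert _ (hc'.nbr l) with h3 | h3
    · rw [h1, h3]
    · exact absurd (h2.trans h1.symm) hwv
    · rw [h1, h3]
    · exact absurd (h3.trans h2.symm) hxw
    · exact absurd (h3.trans h2.symm) hxw
    · rw [h1, h3]
    · exact absurd (h2.trans h1.symm) hwv
    · rw [h1, h3]
  have hst : s l = t i := by
    rw [hx, affine_add_smul, hlc, map_neg] at hxv
    exact mul_right_cancel₀ hi (by linarith)
  have hback : v + t i • b i + s l • c l = v := by
    rw [hst, hlc, smul_neg, add_neg_cancel_right]
  refine ⟨_, hc.nbr i, hwv, fun g => ⟨hc.le_of_level_le hi hl g, fun hg => ?_⟩⟩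
  have := hc'.le_of_level_le hj hl' g hg
  rwa [hback] at this

end Prism

/-! ### Heights and levels of a Cayley sum. -/

/-- Where `g ≥ 0` on the generators, its zero set is a face of the hull, spanned by the generators
on it. Convexity of the set `g > 0` together with the part of `g = 0` over `K` expresses this. -/
theorem mem_of_mem_convexHull_of_eq_zero {E F : Type*} [AddCommGroup E] [Module ℝ E]
    [AddCommGroup F] [Module ℝ F] {U : Set E} (g : E →ᵃ[ℝ] ℝ) (π : E →ᵃ[ℝ] F) {K : Set F}
    (hK : Convex ℝ K) (hU : ∀ y ∈ U, 0 < g y ∨ g y = 0 ∧ π y ∈ K) :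
    ∀ y ∈ convexHull ℝ U, g y = 0 → π y ∈ K := by
  have hconv : Convex ℝ {y | 0 < g y ∨ g y = 0 ∧ π y ∈ K} := by
    rw [convex_iff_forall_pos]
    intro x hx y hy p q hp hq hpq
    have hg : g (p • x + q • y) = p * g x + q * g y := by
      simpa using Convex.combo_affine_apply (f := g) (x := x) (y := y) hpq
    have hπ : π (p • x + q • y) = p • π x + q • π y := Convex.combo_affine_apply hpq
    rw [Set.mem_ofPred_eq, hg, hπ]
    rcases hx with hx | ⟨hx, hx'⟩ <;> rcases hy with hy | ⟨hy, hy'⟩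
    · left; positivity
    · left; rw [hy]; have := mul_pos hp hx; linarith
    · left; rw [hx]; have := mul_pos hq hy; linarith
    · right; exact ⟨by rw [hx, hy]; ring, hK hx' hy' hp.le hq.le hpq⟩
  intro y hy h0
  rcases convexHull_min hU hconv hy with h1 | h1
  · exact absurd h0 h1.ne'
  · exact h1.2

section Cayley

variable {n m k : ℕ} {P : Set (Fin n → ℝ)} {Q : Fin 2 → Set (Fin m → ℝ)}
  {φ : (Fin n → ℝ) ≃ᵃ[ℝ] (Fin m ⊕ Fin 1 → ℝ)}

/-- The height function of a Cayley polytope `[P_0 * P_1]^k`. -/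
noncomputable def cayleyHeight (φ : (Fin n → ℝ) ≃ᵃ[ℝ] (Fin m ⊕ Fin 1 → ℝ)) :
    (Fin n → ℝ) →ᵃ[ℝ] ℝ :=
  (LinearMap.proj (Sum.inr 0) : (Fin m ⊕ Fin 1 → ℝ) →ₗ[ℝ] ℝ).toAffineMap.comp φ.toAffineMap

/-- The projection of a Cayley polytope `[P_0 * P_1]^k` to the space of `P_0` and `P_1`. -/
noncomputable def cayleyBase (φ : (Fin n → ℝ) ≃ᵃ[ℝ] (Fin m ⊕ Fin 1 → ℝ)) :
    (Fin n → ℝ) →ᵃ[ℝ] (Fin m → ℝ) :=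
  (LinearMap.funLeft ℝ ℝ Sum.inl : (Fin m ⊕ Fin 1 → ℝ) →ₗ[ℝ] (Fin m → ℝ)).toAffineMap.comp
    φ.toAffineMap

theorem cayleyHeight_apply (x : Fin n → ℝ) : cayleyHeight φ x = φ x (Sum.inr 0) := rfl

theorem cayleyBase_apply (x : Fin n → ℝ) : cayleyBase φ x = fun j => φ x (Sum.inl j) := rfl

theorem cayleyHeight_symm (z : Fin m → ℝ) (i : Fin 2) :
    cayleyHeight φ (φ.symm (Sum.elim z ((k : ℝ) • cayleyVertex i))) = k * cayleyVertex i 0 := by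
  rw [cayleyHeight_apply, AffineEquiv.apply_symm_apply]
  rfl

theorem cayleyBase_symm (z : Fin m → ℝ) (i : Fin 2) :
    cayleyBase φ (φ.symm (Sum.elim z ((k : ℝ) • cayleyVertex i))) = z := by
  rw [cayleyBase_apply, AffineEquiv.apply_symm_apply]
  rfl

theorem symm_elim_cayleyBase {x : Fin n → ℝ} {i : Fin 2}
    (hx : cayleyHeight φ x = k * cayleyVertex i 0) :
    φ.symm (Sum.elim (cayleyBase φ x) ((k : ℝ) • cayleyVertex i)) = x := by
  rw [AffineEquiv.symm_apply_eq]
  ext (j | j)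
  · rfl
  · rw [Fin.fin_one_eq_zero j, ← cayleyHeight_apply, hx]
    rfl

theorem eq_convexHull_of_image_eq (hφ : φ '' P = cayleySum k Q) :
    P = convexHull ℝ (φ.symm '' ⋃ i, (fun x => Sum.elim x ((k : ℝ) • cayleyVertex i)) '' Q i) := by
  have h1 : φ.symm '' (φ '' P) = P := by
    rw [Set.image_image]
    simp
  rw [← h1, hφ, cayleySum]
  exact φ.symm.toAffineMap.image_convexHull _

theorem extremePoints_height (hφ : φ '' P = cayleySum k Q) {x : Fin n → ℝ}
    (hx : x ∈ P.extremePoints ℝ) : ∃ i : Fin 2, cayleyHeight φ x = k * cayleyVertex i 0 := by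
  rw [eq_convexHull_of_image_eq hφ] at hx
  obtain ⟨y, hy, rfl⟩ := extremePoints_convexHull_subset hx
  obtain ⟨i, z, -, rfl⟩ := Set.mem_iUnion.1 hy
  exact ⟨i, cayleyHeight_symm z i⟩

theorem isSlab_cayleyHeight (hP : IsSmoothPolytope P)
    (hlat : φ '' latticePoints (Fin n) = latticePoints (Fin m ⊕ Fin 1))
    (hφ : φ '' P = cayleySum k Q) : IsSlab P (cayleyHeight φ) k := by
  have hlin : ∀ x y, (cayleyHeight φ).linear (x - y) = cayleyHeight φ x - cayleyHeight φ y :=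
    fun x y => (cayleyHeight φ).linearMap_vsub x y
  have hprim : ∃ x ∈ latticePoints (Fin n), (cayleyHeight φ).linear x = 1 := by
    -- `φ` is affine and need not fix the origin, so a lattice vector of height `1` is found as a
    -- difference of preimages.
    have h0 : (realVec 0 : Fin m ⊕ Fin 1 → ℝ) ∈ latticePoints _ := ⟨0, rfl⟩
    have h1 : (realVec (Pi.single (Sum.inr 0) 1) : Fin m ⊕ Fin 1 → ℝ) ∈ latticePoints _ := ⟨_, rfl⟩
    rw [← hlat] at h0 h1
    obtain ⟨x, hx, hx'⟩ := h0
    obtain ⟨y, hy, hy'⟩ := h1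
    refine ⟨y - x, sub_mem_latticePoints hy hx, ?_⟩
    rw [hlin, cayleyHeight_apply, cayleyHeight_apply, hx', hy']
    simp
  have hvert : ∀ x ∈ P.extremePoints ℝ, cayleyHeight φ x = 0 ∨ cayleyHeight φ x = k := by
    intro x hx
    obtain ⟨i, hi⟩ := extremePoints_height hφ hx
    fin_cases i
    · left; rw [hi]; exact mul_zero _
    · right; rw [hi]
      change (k : ℝ) * cayleyVertex (Fin.succ 0) 0 = k
      rw [cayleyVertex_succ]
      simp
  refine ⟨hP, ?_, fun x hx => ?_, hprim, hvert⟩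
  -- For `k = 0` all vertices, hence all edges at a vertex, would be horizontal, against
  -- primitivity.
  · by_contra hk
    have hk0 : k = 0 := by omega
    subst hk0
    obtain ⟨v, hv⟩ := hP.1.exists_extremePoint
    obtain ⟨b, t, hc⟩ := hP.exists_vertexChart hv
    have hzero : ∀ x ∈ P.extremePoints ℝ, cayleyHeight φ x = 0 := fun x hx => by
      simpa using hvert x hx
    have hbz : ∀ i, (cayleyHeight φ).linear (b i) = 0 := by
      intro i
      have h1 := affine_add_smul (cayleyHeight φ) v (b i) (t i)
      rw [hzero _ hv, hzero _ (hc.nbr i), zero_add, eq_comm] at h1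
      exact (mul_eq_zero.1 h1).resolve_left (hc.pos i).ne'
    obtain ⟨x, -, hx⟩ := hprim
    rw [linear_eq_sum _ b] at hx
    simp [hbz] at hx
  · have h0 : (0 : Fin n → ℝ) ∈ latticePoints (Fin n) := ⟨0, by ext; simp⟩
    have h1 : φ x ∈ latticePoints _ := hlat ▸ Set.mem_image_of_mem φ hx
    have h2 : φ 0 ∈ latticePoints _ := hlat ▸ Set.mem_image_of_mem φ h0
    obtain ⟨y, hy⟩ := sub_mem_latticePoints h1 h2
    refine ⟨y (Sum.inr 0), ?_⟩
    have h3 := hlin x 0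
    rw [sub_zero] at h3
    rw [h3]
    exact (congrFun hy (Sum.inr 0)).symm

/-- A supporting functional for each level: `h` at the bottom and `k - h` at the top. -/
theorem exists_level_functional (hk : 0 < k) (i : Fin 2) (h : (Fin n → ℝ) →ᵃ[ℝ] ℝ) :
    ∃ g : (Fin n → ℝ) →ᵃ[ℝ] ℝ, (∀ x, h x = k * cayleyVertex i 0 → g x = 0) ∧
      ∀ x (j : Fin 2), j ≠ i → h x = k * cayleyVertex j 0 → 0 < g x := by
  have h0 : cayleyVertex (0 : Fin 2) 0 = 0 := rfl
  have h1 : cayleyVertex (1 : Fin 2) 0 = 1 := by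
    change cayleyVertex (Fin.succ 0) 0 = 1
    rw [cayleyVertex_succ]
    simp
  have hk' : (0 : ℝ) < k := by exact_mod_cast hk
  have hcases : ∀ j : Fin 2, j = 0 ∨ j = 1 := by decide
  rcases hcases i with rfl | rfl
  · refine ⟨h, fun x hx => by rw [hx, h0, mul_zero], fun x j hj hx => ?_⟩
    rcases hcases j with rfl | rfl
    · exact absurd rfl hj
    · rw [hx, h1, mul_one]; exact hk'
  · refine ⟨AffineMap.const ℝ _ (k : ℝ) - h, fun x hx => ?_, fun x j hj hx => ?_⟩
    · simp [hx, h1]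
    · rcases hcases j with rfl | rfl
      · simpa [hx, h0] using hk
      · exact absurd rfl hj

/-- The level sets of a Cayley polytope at its two extremal heights. -/
theorem cayleyBase_mem (hk : 0 < k) (hQ : ∀ i, Convex ℝ (Q i)) (hφ : φ '' P = cayleySum k Q)
    {x : Fin n → ℝ} (hx : x ∈ P) {i : Fin 2} (hxi : cayleyHeight φ x = k * cayleyVertex i 0) :
    cayleyBase φ x ∈ Q i := by
  obtain ⟨g, hg0, hg1⟩ := exists_level_functional hk i (cayleyHeight φ)
  rw [eq_convexHull_of_image_eq hφ] at hx
  refine mem_of_mem_convexHull_of_eq_zero g (cayleyBase φ) (hQ i) ?_ x hx (hg0 x hxi)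
  rintro _ ⟨y, hy, rfl⟩
  obtain ⟨j, z, hz, rfl⟩ := Set.mem_iUnion.1 hy
  by_cases hji : j = i
  · subst hji
    exact Or.inr ⟨hg0 _ (cayleyHeight_symm z j), by dsimp only; rwa [cayleyBase_symm]⟩
  · exact Or.inl (hg1 _ j hji (cayleyHeight_symm z j))

theorem symm_elim_mem (hφ : φ '' P = cayleySum k Q) {i : Fin 2} {z : Fin m → ℝ} (hz : z ∈ Q i) :
    φ.symm (Sum.elim z ((k : ℝ) • cayleyVertex i)) ∈ P := by
  rw [eq_convexHull_of_image_eq hφ]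
  exact subset_convexHull ℝ _ ⟨_, Set.mem_iUnion.2 ⟨i, z, hz, rfl⟩, rfl⟩

/-- The points of `Q i` lying below or above the vertices of `P`. -/
def levelVertices (P : Set (Fin n → ℝ)) (φ : (Fin n → ℝ) ≃ᵃ[ℝ] (Fin m ⊕ Fin 1 → ℝ)) (k : ℕ)
    (i : Fin 2) : Set (Fin m → ℝ) :=
  {z | φ.symm (Sum.elim z ((k : ℝ) • cayleyVertex i)) ∈ P.extremePoints ℝ}

theorem levelVertices_subset (hk : 0 < k) (hQ : ∀ i, Convex ℝ (Q i)) (hφ : φ '' P = cayleySum k Q)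
    (i : Fin 2) : levelVertices P φ k i ⊆ Q i := by
  intro z hz
  have := cayleyBase_mem hk hQ hφ hz.1 (cayleyHeight_symm z i)
  rwa [cayleyBase_symm] at this

/-- A level of `P` is a face, so `Q i` is the convex hull of the projections of the vertices of `P`
at that level. -/
theorem extremePoints_subset_levelVertices (hk : 0 < k) (hP : IsLatticePolytope P)
    (hQ : ∀ i, Convex ℝ (Q i)) (hφ : φ '' P = cayleySum k Q)
    (i : Fin 2) : (Q i).extremePoints ℝ ⊆ levelVertices P φ k i := by
  have hQi : Q i = convexHull ℝ (levelVertices P φ k i) := by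
    refine Set.Subset.antisymm (fun z hz => ?_)
      (convexHull_min (levelVertices_subset hk hQ hφ i) (hQ i))
    obtain ⟨g, hg0, hg1⟩ := exists_level_functional hk i (cayleyHeight φ)
    have hzP := symm_elim_mem hφ hz
    rw [← hP.convexHull_extremePoints] at hzP
    have := mem_of_mem_convexHull_of_eq_zero g (cayleyBase φ)
      (convex_convexHull ℝ (levelVertices P φ k i)) ?_ _ hzP (hg0 _ (cayleyHeight_symm z i))
    · rwa [cayleyBase_symm] at this
    · intro y hy
      obtain ⟨j, hj⟩ := extremePoints_height hφ hy
      by_cases hji : j = i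
      · subst hji
        refine Or.inr ⟨hg0 y hj, subset_convexHull ℝ _ ?_⟩
        change φ.symm _ ∈ P.extremePoints ℝ
        rwa [symm_elim_cayleyBase hj]
      · exact Or.inl (hg1 y j hji hj)
  rw [hQi]
  exact extremePoints_convexHull_subset

/-- Pulling `u` back along the projection turns a vertex cone of `Q i` into minimality within a
level of `P`, the form used in `IsSlab.exists_opposite`. -/
theorem mem_normalCone_iff_level (hk : 0 < k) (hQ : ∀ i, Convex ℝ (Q i))
    (hφ : φ '' P = cayleySum k Q) {x : Fin n → ℝ} {i : Fin 2}
    (hx : cayleyHeight φ x = k * cayleyVertex i 0) (u : StrongDual ℝ (Fin m → ℝ)) :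
    u ∈ normalCone (Q i) {cayleyBase φ x} ↔ ∀ y ∈ P, cayleyHeight φ y = cayleyHeight φ x →
      (u.toLinearMap.toAffineMap.comp (cayleyBase φ)) x ≤
        (u.toLinearMap.toAffineMap.comp (cayleyBase φ)) y := by
  rw [mem_normalCone_singleton]
  constructor
  · intro h y hy hyx
    exact h _ (cayleyBase_mem hk hQ hφ hy (hyx.trans hx))
  · intro h z hz
    have := h _ (symm_elim_mem hφ hz) ((cayleyHeight_symm z i).trans hx.symm)
    simp only [AffineMap.coe_comp, Function.comp_apply, cayleyBase_symm] at this
    exact this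

theorem normalFan_eq_of_prism (hP : IsSmoothPolytope P) (hQ : ∀ i, IsLatticePolytope (Q i))
    (hφ : φ '' P = cayleySum k Q) (hs : IsSlab P (cayleyHeight φ) k)
    (hpr : ∀ v ∈ P.extremePoints ℝ, ∀ b t, IsVertexChart P v b t → IsPrismAt (cayleyHeight φ) b)
    (i j : Fin 2) : normalFan (Q i) = normalFan (Q j) := by
  have hQc : ∀ i, Convex ℝ (Q i) := fun i => (hQ i).convex
  have key : ∀ i j : Fin 2, i ≠ j → ∀ z ∈ levelVertices P φ k i, ∃ z' ∈ levelVertices P φ k j,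
      normalCone (Q i) {z} = normalCone (Q j) {z'} := by
    intro i j hij z hz
    obtain ⟨w, hw, hwv, hg⟩ := hs.exists_opposite hz hpr
    obtain ⟨j', hj'⟩ := extremePoints_height hφ hw
    have hji : j' ≠ i := by
      rintro rfl
      exact hwv (hj'.trans (cayleyHeight_symm z j').symm)
    have : j' = j := by omega
    subst this
    refine ⟨cayleyBase φ w, ?_, ?_⟩
    · change φ.symm _ ∈ P.extremePoints ℝ
      rwa [symm_elim_cayleyBase hj']
    · ext u
      have h1 := mem_normalCone_iff_level hs.pos hQc hφ (cayleyHeight_symm z i) u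
      rw [cayleyBase_symm] at h1
      rw [h1, mem_normalCone_iff_level hs.pos hQc hφ hj' u]
      exact hg _
  by_cases hij : i = j
  · rw [hij]
  refine normalFan_eq_of_vertexCones (hQ i)
    (extremePoints_subset_levelVertices hs.pos hP.1 hQc hφ i) (levelVertices_subset hs.pos hQc hφ i)
    (hQ j) (extremePoints_subset_levelVertices hs.pos hP.1 hQc hφ j)
    (levelVertices_subset hs.pos hQc hφ j) (key i j hij) fun w hw => ?_
  obtain ⟨z, hz, e⟩ := key j i (Ne.symm hij) w hw
  exact ⟨z, hz, e.symm⟩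

end Cayley

/-! ### The proposition. -/

theorem proposition3p6 {n : ℕ} (P : Set (Fin n → ℝ)) (hP : IsSmoothPolytope P)
    (hdim : polytopeDim P ≤ 3) (k : ℕ) {m : ℕ} (P₀ P₁ : Set (Fin m → ℝ))
    (hcay : IsCayleyDecomposition P k (r := 1) ![P₀, P₁]) :
    IsStrictCayleyPolytope P k := by
  obtain ⟨φ, hlat, hφ⟩ := hcay.2.2
  have hs := isSlab_cayleyHeight hP hlat hφ
  rw [hP.polytopeDim_eq] at hdim
  rcases hs.prism_or_strictCayley hdim with hpr | hstrict
  · exact ⟨m, 1, ![P₀, P₁], hcay, normalFan_eq_of_prism hP hcay.1 hφ hs hpr⟩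
  · exact hstrict
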